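/- **Setting.** Items $I=\{1,\dots,n\}$ have states in $[B]=\{1,\dots,B\}$; the state vector $\phi\in[B]^I$ has independent coordinates with known laws $p_i$. The utility $f:[0;B]^I\to\mathbb R_+$, where $[0;B]=\{0,\dots,B\}$, is monotone and lattice-submodular: $f(u\vee s\mathbf 1_i)-f(u)\ge f(v\vee s\mathbf 1_i)-f(v)$ for all $u\le v$, $i\in I$, $s\in[0;B]$. Item $i$ in state $s$ has cost $c_i(s)\in\mathbb Z_{\ge0}$, nondecreasing in $s$; the budget is $C\in\mathbb Z_{\ge0}$; $\mathcal I^{out}\subseteq 2^I$ is nonempty and downward closed. An adaptive policy $\pi$ selects items one at a time, depending on the states of the items already selected; $I(\pi,\phi)$ is its selected set. It is feasible if for every $\phi\in[B]^I$ both $\sum_{i\in I(\pi,\phi)}c_i(\phi(i))\le C$ (inner constraint) and $I(\pi,\phi)\in\mathcal I^{out}$ (outer constraint). For $S\subseteq I$ let $\phi_S$ equal $\phi$ on $S$ and $0$ elsewhere; $f_{avg}(\pi)=\mathbb E[f(\phi_{I(\pi,\phi)})]$ and $\bar f(S)=\mathbb E[f(\phi_S)]$. A randomized policy is a probability distribution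 on deterministic policies; it is feasible if all policies in its support are, and its utility is the average. **Contention resolution.** Let $P_{\mathcal I^{out}}=\mathrm{conv}\{\mathbf 1_S: S\in\mathcal I^{out}\}$ and $\beta,\gamma\in[0,1]$. A monotone $(\beta,\gamma)$-balanced contention resolution scheme (CRS) for $\mathcal I^{out}$ gives for every $z\in\beta\cdot P_{\mathcal I^{out}}$ a random map $\chi_z:2^I\to\mathcal I^{out}$ with $\chi_z(R)\subseteq R$ such that: if $R$ contains each $i$ independently with probability $z(i)$, then $\Pr[i\in\chi_z(R)\mid i\in R]\ge\gamma$ for every $i$ with $z(i)>0$; and $\Pr[i\in\chi_z(R)]\ge\Pr[i\in\chi_z(R')]$ for all fixed sets $R\subseteq R'$ and $i\in R$. **Continuous problem.** Time slots are numbered from $t_0\in\{0,1\}$; if $t_0=1$, assume that no item has $c_i(B)=C$. Let $T_i=\{t\in\mathbb Z: t_0\le t\le C-c_i(B)\}$. A fractional solution is a family $x(i,t)\ge0$, zero for $t\notin T_i$, such that $\bar x(i)=\sum_{t\in T_i}x(i,t)$ satisfies $\bar x(i)\le1$, $\bar x\in P_{\mathcal I^{out}}$, and $\sum_i\mathbb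 E[\min\{c_i(\phi(i)),t\}]\sum_{t_0\le t'\le t}x(i,t')\le2t$ for $t=1,\dots,C$. Let $F(\bar x)=\sum_{U\subseteq I}\prod_{i\in U}\bar x(i)\prod_{i\notin U}(1-\bar x(i))\bar f(U)$. The continuous greedy algorithm with stopping time $l$ and step size $\delta>0$ starts from $y=0$ at time $0$; while the elapsed time is less than $l$, it chooses a fractional solution $v$ maximizing $\sum_i\partial_iF(\bar y)\,\bar v(i)$ and replaces $y$ by $y+hv$, where $h$ is the minimum of $\delta$ and the remaining time; it outputs $y$ at time $l$. **Policy $\pi^{io}$.** Compute an output $y$ of continuous greedy with $l=\min\{\beta,1/4\}$. Draw $R$ by including each $i$ independently with probability $\bar y(i)$; draw $S=\chi_{\bar y}(R)$; for each $i\in S$ draw independently a starting time $\tau(i)\in T_i$, equal to $t$ with probability $y(i,t)/\bar y(i)$. Visit the items of $S$ in nondecreasing order of $\tau$, ties broken by least index; select a visited item $i$ exactly if the total realized cost of the items selected so far is at most $\tau(i)$, and then observe its state. **Theorem.** Let the step size $\delta=\delta(n)>0$ satisfy $\delta(n)=o(n^{-3})$. There is a sequence $\varepsilon(n)\to0$,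 depending only on the function $\delta(\cdot)$, such that for every instance as above with $n$ items, all $\beta,\gamma\in[0,1]$ and every monotone $(\beta,\gamma)$-balanced CRS for $\mathcal I^{out}$: continuous greedy with step size $\delta(n)$ has an output, and for every output $y$, $\pi^{io}$ is a randomized policy that is feasible for the inner and outer constraints, and for every feasible adaptive policy $\pi$ (in particular an optimal one) $$f_{avg}(\pi^{io})\ \ge\ \bigl(1-\min\{2\beta,1/2\}\bigr)\,\gamma\,\bigl(1-e^{-\min\{\beta,1/4\}}-\varepsilon(n)\bigr)\,f_{avg}(\pi).$$ -/

import Mathlib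

open scoped Pointwise

noncomputable section

/-- A function on `[0;B]^I` is lattice-submodular if the gain of raising coordinate `i` to level `s`
is nonincreasing in the current vector. -/
def LatticeSubmodular {n B : ℕ} (f : (Fin n → Fin (B + 1)) → ℝ) : Prop :=
  ∀ u v : Fin n → Fin (B + 1), u ≤ v → ∀ (i : Fin n) (s : Fin (B + 1)),
    f (v ⊔ Pi.single i s) - f v ≤ f (u ⊔ Pi.single i s) - f u

/-- An instance of the problem with items `Fin n`. The state space `[B] = {1, …, B}` is `Fin B`, where
`s : Fin B` stands for the state `s + 1`; `Fin (B + 1)` is `[0;B]`, with `0` for "not selected". -/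
structure Problem (n B : ℕ) where
  /-- the utility function -/
  f : (Fin n → Fin (B + 1)) → ℝ
  f_nonneg : ∀ u, 0 ≤ f u
  /-- `p i s` is the probability that item `i` is in state `s` -/
  p : Fin n → Fin B → ℝ
  p_nonneg : ∀ i s, 0 ≤ p i s
  p_sum : ∀ i, ∑ s, p i s = 1
  /-- state-dependent costs -/
  c : Fin n → Fin B → ℕ
  /-- the budget of the inner constraint -/
  C : ℕ
  /-- the outer constraint -/
  Iout : Set (Finset (Fin n))
  Iout_lower : IsLowerSet Iout
  Iout_nonempty : Iout.Nonempty

/-- Deterministic adaptive policies, as decision trees: halt, or select an item `i`, observe its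
state `s`, and continue with `next s`. -/
inductive Policy (n B : ℕ) : Type
  | halt : Policy n B
  | select (i : Fin n) (next : Fin B → Policy n B) : Policy n B

/-- `I(π, φ)`: the set of items selected by `π` under the realization `φ`. -/
def Policy.selected {n B : ℕ} : Policy n B → (Fin n → Fin B) → Finset (Fin n)
  | .halt, _ => ∅
  | .select i next, φ => insert i ((next (φ i)).selected φ)

/-- `φ_S`: the vector that equals `φ` on `S` and `0` elsewhere. -/
def restrictTo {n B : ℕ} (φ : Fin n → Fin B) (S : Finset (Fin n)) : Fin n → Fin (B + 1) :=
  fun i => if i ∈ S then (φ i).succ else 0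

/-- The probability that independently including each `i` with probability `x i` gives the set `U`. -/
def inclusionProb {n : ℕ} (x : Fin n → ℝ) (U : Finset (Fin n)) : ℝ :=
  (∏ i ∈ U, x i) * ∏ i ∈ Uᶜ, (1 - x i)

/-- A randomized set map on subsets of `Fin n`: `χ R S` is the probability that `χ(R) = S`. -/
abbrev RandomSetMap (n : ℕ) := Finset (Fin n) → Finset (Fin n) → ℝ

/-- `Pr[i ∈ χ(R)]` for a fixed set `R`, over the randomness of `χ`. -/
def RandomSetMap.probMem {n : ℕ} (χ : RandomSetMap n) (R : Finset (Fin n)) (i : Fin n) : ℝ :=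
  ∑ S with i ∈ S, χ R S

/-- `χ` is a monotone contention resolution scheme into the family `F`, balanced with factor `γ` with
regard to the inclusion probabilities `z`. The set `R` contains each `i` independently with
probability `z i`, so `Pr[i ∈ R] = z i`, and the balance condition is
`Pr[i ∈ χ(R) | i ∈ R] ≥ γ` whenever `i ∈ R` has positive probability. -/
structure IsMonotoneBalancedCRSAt {n : ℕ} (F : Set (Finset (Fin n))) (γ : ℝ) (z : Fin n → ℝ)
    (χ : RandomSetMap n) : Prop where
  nonneg : ∀ R S, 0 ≤ χ R S
  sum_eq_one : ∀ R, ∑ S, χ R S = 1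
  subset : ∀ R S, χ R S ≠ 0 → S ⊆ R
  mem : ∀ R S, χ R S ≠ 0 → S ∈ F
  balanced : ∀ i, 0 < z i →
    γ ≤ (∑ R with i ∈ R, inclusionProb z R * χ.probMem R i) / z i
  monotone : ∀ R R' : Finset (Fin n), R ⊆ R' → ∀ i ∈ R, χ.probMem R' i ≤ χ.probMem R i

/-- The convex hull of the indicator vectors of the members of `F`. -/
def familyPolytope {n : ℕ} (F : Set (Finset (Fin n))) : Set (Fin n → ℝ) :=
  convexHull ℝ ((fun S : Finset (Fin n) => fun i => if i ∈ S then (1 : ℝ) else 0) '' F)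

/-- A monotone `(β, γ)`-balanced contention resolution scheme for `F`: one scheme `χ z` for every
vector `z ∈ β · P_F`. -/
def IsMonotoneBalancedCRS {n : ℕ} (F : Set (Finset (Fin n))) (β γ : ℝ)
    (χ : (Fin n → ℝ) → RandomSetMap n) : Prop :=
  ∀ z ∈ β • familyPolytope F, IsMonotoneBalancedCRSAt F γ z (χ z)

/-- A randomized policy: a finitely supported weight function on deterministic policies. -/
abbrev RandomPolicy (n B : ℕ) := Policy n B →₀ ℝ

/-- The weights of a randomized policy are the probabilities of a distribution. -/
def RandomPolicy.IsProbability {n B : ℕ} (ρ : RandomPolicy n B) : Prop :=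
  (∀ π, 0 ≤ ρ π) ∧ (ρ.sum fun _ w => w) = 1

namespace Problem

variable {n B : ℕ}

/-- The probability of the realization `φ` under the product prior. -/
def prob (P : Problem n B) (φ : Fin n → Fin B) : ℝ := ∏ i, P.p i (φ i)

/-- `f_avg(π)`, the expected utility of a deterministic policy. -/
def favg (P : Problem n B) (π : Policy n B) : ℝ :=
  ∑ φ : Fin n → Fin B, P.prob φ * P.f (restrictTo φ (π.selected φ))

/-- The expected utility of a randomized policy. -/
def favgRandom (P : Problem n B) (ρ : RandomPolicy n B) : ℝ :=
  ρ.sum fun π w => w * P.favg π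

/-- `π` satisfies the inner and the outer constraint under every realization. -/
def Feasible (P : Problem n B) (π : Policy n B) : Prop :=
  (∀ φ : Fin n → Fin B, ∑ i ∈ π.selected φ, P.c i (φ i) ≤ P.C) ∧
    ∀ φ : Fin n → Fin B, π.selected φ ∈ P.Iout

/-- A randomized policy is feasible if every deterministic policy it may run is. -/
def FeasibleRandom (P : Problem n B) (ρ : RandomPolicy n B) : Prop :=
  ∀ π ∈ ρ.support, P.Feasible π

/-- The expected utility of the set `S` of items. -/
def fbar (P : Problem n B) (S : Finset (Fin n)) : ℝ :=
  ∑ φ : Fin n → Fin B, P.prob φ * P.f (restrictTo φ S)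

/-- The multilinear extension of `fbar`. -/
def F (P : Problem n B) (x : Fin n → ℝ) : ℝ :=
  ∑ U : Finset (Fin n), inclusionProb x U * P.fbar U

/-- The partial derivative of `F` at `x` in coordinate `i` (`F` is affine in each coordinate). -/
def gradF (P : Problem n B) (x : Fin n → ℝ) (i : Fin n) : ℝ :=
  P.F (Function.update x i 1) - P.F (Function.update x i 0)

/-- The possible starting times of item `i`, when time slots are numbered from `t₀`: the processing
must end by time `C` whatever the state is. If costs are monotone in the state this is
`{t | t₀ ≤ t ≤ C - c_i(B)}`. -/
def slots (P : Problem n B) (t₀ : ℕ) (i : Fin n) : Finset ℕ :=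
  {t ∈ Finset.Icc t₀ P.C | ∀ s, t + P.c i s ≤ P.C}

/-- `x̄(i) = ∑_t x(i,t)`. -/
def bar (P : Problem n B) (t₀ : ℕ) (x : Fin n → ℕ → ℝ) (i : Fin n) : ℝ :=
  ∑ t ∈ P.slots t₀ i, x i t

/-- `E[min{c_i(φ(i)), t}]`. -/
def truncCost (P : Problem n B) (i : Fin n) (t : ℕ) : ℝ :=
  ∑ s, P.p i s * (min (P.c i s) t : ℕ)

/-- The feasible region of the continuous problem. -/
structure IsFractional (P : Problem n B) (t₀ : ℕ) (x : Fin n → ℕ → ℝ) : Prop where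
  nonneg : ∀ i t, 0 ≤ x i t
  eq_zero : ∀ i, ∀ t ∉ P.slots t₀ i, x i t = 0
  bar_le_one : ∀ i, P.bar t₀ x i ≤ 1
  bar_mem : P.bar t₀ x ∈ familyPolytope P.Iout
  knapsack : ∀ t ∈ Finset.Icc 1 P.C,
    ∑ i, P.truncCost i t * ∑ t' ∈ Finset.Icc t₀ t, x i t' ≤ 2 * (t : ℝ)

/-- `y` is a possible output of the continuous greedy algorithm with stopping time `l` and step size
`δ`: start from `0`; in each step move, for a time `δ` (for the remaining time in the last step), in
the direction of some feasible `v` that maximizes the inner product of `v̄` with the gradient of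
`F`; end at time `l`. -/
def IsGreedyOutput (P : Problem n B) (t₀ : ℕ) (l δ : ℝ) (y : Fin n → ℕ → ℝ) : Prop :=
  ∃ Y : ℕ → Fin n → ℕ → ℝ, Y 0 = 0 ∧ Y ⌈l / δ⌉₊ = y ∧
    ∀ k < ⌈l / δ⌉₊, ∃ v, P.IsFractional t₀ v ∧
      (∀ w, P.IsFractional t₀ w →
        ∑ i, P.gradF (P.bar t₀ (Y k)) i * P.bar t₀ w i ≤
          ∑ i, P.gradF (P.bar t₀ (Y k)) i * P.bar t₀ v i) ∧
      Y (k + 1) = Y k + min δ (l - k * δ) • v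

/-- The items of `S` in nondecreasing order of starting time, ties broken by least index. -/
def schedule (S : Finset (Fin n)) (τ : Fin n → ℕ) : List (Fin n) :=
  ((S.image fun i => toLex (τ i, i)).sort (· ≤ ·)).map fun q => (ofLex q).2

/-- The adaptive loop: visit the items of a list in order, keeping the realized cost `C'` of the items
selected so far; select the visited item `i` exactly if `C' ≤ τ i`. -/
def visit (P : Problem n B) (τ : Fin n → ℕ) : List (Fin n) → ℕ → Policy n B
  | [], _ => .halt
  | i :: σ, C' =>
    if C' ≤ τ i then .select i fun s => P.visit τ σ (C' + P.c i s) else P.visit τ σ C'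

/-- The policy `π^io` for a fractional solution `y` and a contention resolution scheme `χ`: draw `R` by
including each `i` independently with probability `ȳ(i)`, draw `S` from the scheme (for the
vector `ȳ`) applied to `R`, draw independently for each `i ∈ S` a starting time `τ i` with
probabilities `y(i,t)/ȳ(i)` (outside `S`, `τ` is the dummy `0`), and run the adaptive loop. -/
def ioPolicy (P : Problem n B) (t₀ : ℕ) (y : Fin n → ℕ → ℝ)
    (χ : (Fin n → ℝ) → RandomSetMap n) : RandomPolicy n B :=
  ∑ R : Finset (Fin n), ∑ S : Finset (Fin n),
    ∑ τ ∈ Fintype.piFinset fun i => if i ∈ S then P.slots t₀ i else {0},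
      Finsupp.single (P.visit τ (schedule S τ) 0)
        (inclusionProb (P.bar t₀ y) R * χ (P.bar t₀ y) R S *
          ∏ i ∈ S, y i (τ i) / P.bar t₀ y i)

end Problem

end

/-! Put l = min{β, 1/4}. Two estimates are chained through F(ȳ): greedy gives F(ȳ) ≥ (1 - e^{-l} -
2nδ) f_avg(π) (`IsGreedyOutput.favg_le`), and rounding gives f_avg(π^io) ≥ (1 - 2l) γ F(ȳ)
(`IsScaledFractional.F_le_favgRandom`).

Greedy. The law of the start times of a feasible policy π is itself a fractional solution
(`isFractional_slotProb`): among the items started by time t, those before the last cost at most t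
together and the last, truncated, at most t; and the start time of an item is independent of its
state. Adding the items of π to an independent random set with its own realization, submodularity
gives f_avg(π) - F(x) ≤ ∑ ∂_iF(x) Pr[i selected by π] (`favg_sub_F_le`). Hence the best direction
gains at least the current gap per unit of time, up to the factor (1 - 2δ)^n for the finite step
(`F_add_pow_mul_le`), and the gap decays exponentially.

Rounding. The utility of R telescopes in index order into marginals. Item i with starting time t can
be blocked only if the other items of S starting by t cost more than t. Markov's inequality for
truncated costs, with the knapsack constraint scaled by l, bounds this probability by 2l
(`IsScaledFractional.le_jointE_avgSlack`). The probability that i survives contention resolution,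
its marginal gain and the Markov bound are all antitone in the random set and the realization, so by
Harris' inequality the expectation of their product is at least the product of their expectations
(`IsScaledFractional.item_bound`). -/

/-! ### Independent random sets. -/

section Inclusion

variable {n : ℕ}

theorem inclusionProb_eq_prod (x : Fin n → ℝ) (U : Finset (Fin n)) :
    inclusionProb x U = ∏ i, if i ∈ U then x i else 1 - x i := by
  rw [Finset.prod_ite, inclusionProb]
  congr 1
  · congr 1; ext; simp
  · congr 1; ext; simp

theorem inclusionProb_nonneg {x : Fin n → ℝ} (h0 : ∀ i, 0 ≤ x i) (h1 : ∀ i, x i ≤ 1)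
    (U : Finset (Fin n)) : 0 ≤ inclusionProb x U :=
  mul_nonneg (Finset.prod_nonneg fun i _ => h0 i)
    (Finset.prod_nonneg fun i _ => sub_nonneg.2 (h1 i))

theorem sum_inclusionProb (x : Fin n → ℝ) : ∑ U, inclusionProb x U = 1 := by
  have h := Finset.prod_add x (fun i => 1 - x i) Finset.univ
  simp only [add_sub_cancel, Finset.prod_const_one, Finset.powerset_univ] at h
  rw [h]
  exact Finset.sum_congr rfl fun U _ => by rw [inclusionProb, Finset.compl_eq_univ_sdiff]

theorem inclusionProb_update_of_mem (x : Fin n → ℝ) (i : Fin n) (a : ℝ) {U : Finset (Fin n)}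
    (hU : i ∈ U) : inclusionProb (Function.update x i a) U =
      a * ∏ j ∈ Finset.univ.erase i, if j ∈ U then x j else 1 - x j := by
  rw [inclusionProb_eq_prod, ← Finset.mul_prod_erase _ _ (Finset.mem_univ i)]
  simp only [hU, if_true, Function.update_self]
  congr 1
  exact Finset.prod_congr rfl fun j hj => by rw [Function.update_of_ne (Finset.ne_of_mem_erase hj)]

theorem inclusionProb_update_of_notMem (x : Fin n → ℝ) (i : Fin n) (a : ℝ) {U : Finset (Fin n)}
    (hU : i ∉ U) : inclusionProb (Function.update x i a) U =
      (1 - a) * ∏ j ∈ Finset.univ.erase i, if j ∈ U then x j else 1 - x j := by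
  rw [inclusionProb_eq_prod, ← Finset.mul_prod_erase _ _ (Finset.mem_univ i)]
  simp only [hU, if_false, Function.update_self]
  congr 1
  exact Finset.prod_congr rfl fun j hj => by rw [Function.update_of_ne (Finset.ne_of_mem_erase hj)]

theorem sum_inclusionProb_update_split (x : Fin n → ℝ) (i : Fin n) (a : ℝ)
    (g : Finset (Fin n) → ℝ) :
    ∑ U, inclusionProb (Function.update x i a) U * g U =
      ∑ U ∈ (Finset.univ.erase i).powerset,
        (∏ j ∈ Finset.univ.erase i, if j ∈ U then x j else 1 - x j) *
          (a * g (insert i U) + (1 - a) * g U) := by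
  have hi : i ∉ Finset.univ.erase i := Finset.notMem_erase _ _
  rw [← Finset.powerset_univ, ← Finset.insert_erase (Finset.mem_univ i),
    Finset.sum_powerset_insert hi, ← Finset.sum_add_distrib, Finset.erase_insert hi]
  refine Finset.sum_congr rfl fun U hU => ?_
  have hiU : i ∉ U := fun h => hi (Finset.mem_powerset.1 hU h)
  rw [inclusionProb_update_of_mem x i a (Finset.mem_insert_self i U),
    inclusionProb_update_of_notMem x i a hiU]
  have : (∏ j ∈ Finset.univ.erase i, if j ∈ insert i U then x j else 1 - x j) =
      ∏ j ∈ Finset.univ.erase i, if j ∈ U then x j else 1 - x j :=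
    Finset.prod_congr rfl fun j hj => by
      simp [Finset.mem_insert, Finset.ne_of_mem_erase hj]
  rw [this]; ring

theorem sum_inclusionProb_update (x : Fin n → ℝ) (i : Fin n) (a : ℝ) (g : Finset (Fin n) → ℝ) :
    ∑ U, inclusionProb (Function.update x i a) U * g U =
      a * ∑ U, inclusionProb x U * g (insert i U) +
        (1 - a) * ∑ U, inclusionProb x U * g (U.erase i) := by
  have h1 := sum_inclusionProb_update_split x i (x i) fun U => g (insert i U)
  have h2 := sum_inclusionProb_update_split x i (x i) fun U => g (U.erase i)
  rw [Function.update_eq_self] at h1 h2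
  rw [sum_inclusionProb_update_split, h1, h2, Finset.mul_sum, Finset.mul_sum,
    ← Finset.sum_add_distrib]
  refine Finset.sum_congr rfl fun U hU => ?_
  have hiU : i ∉ U := fun h => Finset.notMem_erase i _ (Finset.mem_powerset.1 hU h)
  rw [Finset.insert_idem, Finset.erase_insert hiU, Finset.erase_eq_of_notMem hiU]
  ring

theorem sum_inclusionProb_mem (x : Fin n → ℝ) (i : Fin n) (g : Finset (Fin n) → ℝ) :
    ∑ U, inclusionProb x U * (if i ∈ U then g U else 0) =
      x i * ∑ U, inclusionProb x U * g (insert i U) := by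
  have h := sum_inclusionProb_update x i (x i) fun U => if i ∈ U then g U else 0
  rw [Function.update_eq_self] at h
  simpa using h

/-- Product weights satisfy the lattice condition of `fkg` with equality, coordinate by coordinate;
`prob_mul_prob` is the counterpart for states. -/
theorem inclusionProb_mul_inclusionProb (x : Fin n → ℝ) (R S : Finset (Fin n)) :
    inclusionProb x R * inclusionProb x S =
      inclusionProb x (R ∩ S) * inclusionProb x (R ∪ S) := by
  simp only [inclusionProb_eq_prod, ← Finset.prod_mul_distrib]
  refine Finset.prod_congr rfl fun i _ => ?_
  by_cases h1 : i ∈ R <;> by_cases h2 : i ∈ S <;> simp [h1, h2, mul_comm]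

/-- Changing the inclusion probabilities upwards, while the exclusion probabilities keep at least the
fraction `a`, keeps at least the fraction `a ^ n` of the probability of every set. -/
theorem pow_mul_inclusionProb_le {x y : Fin n → ℝ} {a : ℝ} (ha0 : 0 ≤ a) (ha1 : a ≤ 1)
    (hx0 : ∀ i, 0 ≤ x i) (hx1 : ∀ i, x i ≤ 1) (hxy : ∀ i, x i ≤ y i)
    (hy : ∀ i, a * (1 - x i) ≤ 1 - y i) (U : Finset (Fin n)) :
    a ^ n * inclusionProb x U ≤ inclusionProb y U := by
  have hc : a ^ n = ∏ _i : Fin n, a := by simp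
  rw [inclusionProb_eq_prod, inclusionProb_eq_prod, hc, ← Finset.prod_mul_distrib]
  refine Finset.prod_le_prod (fun i _ => ?_) fun i _ => ?_
  · split_ifs
    · exact mul_nonneg ha0 (hx0 i)
    · exact mul_nonneg ha0 (sub_nonneg.2 (hx1 i))
  · split_ifs
    · exact (mul_le_of_le_one_left (hx0 i) ha1).trans (hxy i)
    · exact hy i

end Inclusion

/-! ### The product prior, and Harris' inequality for a random set with a random realization. -/

namespace Problem

variable {n B : ℕ} (P : Problem n B)

theorem prob_nonneg (φ : Fin n → Fin B) : 0 ≤ P.prob φ :=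
  Finset.prod_nonneg fun i _ => P.p_nonneg i _

theorem sum_prob : ∑ φ, P.prob φ = 1 := by
  have h := Finset.prod_univ_sum (fun _ : Fin n => (Finset.univ : Finset (Fin B))) P.p
  simp only [P.p_sum, Finset.prod_const_one, Fintype.piFinset_univ] at h
  exact h.symm

/-- Stated as a product because `P.p i (φ i)` may vanish. -/
theorem prob_update_mul (φ : Fin n → Fin B) (i : Fin n) (s : Fin B) :
    P.prob (Function.update φ i s) * P.p i (φ i) = P.prob φ * P.p i s := by
  unfold prob
  rw [← Finset.mul_prod_erase _ _ (Finset.mem_univ i),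
    ← Finset.mul_prod_erase _ (fun j => P.p j (φ j)) (Finset.mem_univ i), Function.update_self,
    Finset.prod_congr rfl fun j hj => by rw [Function.update_of_ne (Finset.ne_of_mem_erase hj)]]
  ring

/-- Drawing the state of one item anew does not change the distribution of the realization. -/
theorem sum_prob_mul_resample (i : Fin n) (g : (Fin n → Fin B) → ℝ) :
    ∑ φ, P.prob φ * g φ = ∑ s, P.p i s * ∑ φ, P.prob φ * g (Function.update φ i s) := by
  -- Exchanging the fresh state with the current state of `i` is an involution that preserves the
  -- joint weight.
  have hinv : Function.Involutive fun q : Fin B × (Fin n → Fin B) =>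
      (q.2 i, Function.update q.2 i q.1) := by
    rintro ⟨s, φ⟩; simp
  calc ∑ φ, P.prob φ * g φ
      = ∑ q : Fin B × (Fin n → Fin B), P.p i q.1 * (P.prob q.2 * g q.2) := by
        simp only [Fintype.sum_prod_type]
        rw [← Fintype.sum_mul_sum, P.p_sum, one_mul]
    _ = ∑ q : Fin B × (Fin n → Fin B),
          P.p i q.1 * (P.prob q.2 * g (Function.update q.2 i q.1)) := by
        refine (Equiv.sum_comp hinv.toPerm _).symm.trans (Finset.sum_congr rfl fun q _ => ?_)
        change P.p i (q.2 i) * (P.prob (Function.update q.2 i q.1) *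
          g (Function.update q.2 i q.1)) = _
        rw [← mul_assoc, ← mul_assoc, mul_comm (P.p i _), P.prob_update_mul, mul_comm (P.prob _)]
    _ = _ := by rw [Fintype.sum_prod_type]; simp only [Finset.mul_sum]

/-- A quantity that does not depend on the state of item `i` is independent of that state. -/
theorem sum_prob_mul_indep (i : Fin n) (g : (Fin n → Fin B) → ℝ) (h : Fin B → ℝ)
    (hg : ∀ φ s, g (Function.update φ i s) = g φ) :
    ∑ φ, P.prob φ * (g φ * h (φ i)) = (∑ φ, P.prob φ * g φ) * ∑ s, P.p i s * h s := by
  rw [P.sum_prob_mul_resample i]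
  simp only [hg, Function.update_self, Finset.mul_sum, Finset.sum_mul]
  exact Finset.sum_congr rfl fun s _ => Finset.sum_congr rfl fun φ _ => by ring

theorem prob_mul_prob (φ ψ : Fin n → Fin B) :
    P.prob φ * P.prob ψ = P.prob (φ ⊓ ψ) * P.prob (φ ⊔ ψ) := by
  simp only [prob, ← Finset.prod_mul_distrib]
  refine Finset.prod_congr rfl fun i _ => ?_
  rcases le_total (φ i) (ψ i) with h | h <;> simp [h, mul_comm]

/-- Expectation over an independent random set, with inclusion probabilities `x`, and a random
realization. -/
noncomputable def jointE (x : Fin n → ℝ) (g : Finset (Fin n) → (Fin n → Fin B) → ℝ) : ℝ :=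
  ∑ R, ∑ φ, inclusionProb x R * P.prob φ * g R φ

variable {P} {x : Fin n → ℝ}

theorem jointE_const (a : ℝ) : P.jointE x (fun _ _ => a) = a := by
  simp only [jointE, ← Finset.sum_mul, ← Fintype.sum_mul_sum, sum_inclusionProb, P.sum_prob,
    one_mul]

theorem jointE_add (f g : Finset (Fin n) → (Fin n → Fin B) → ℝ) :
    P.jointE x (fun R φ => f R φ + g R φ) = P.jointE x f + P.jointE x g := by
  simp only [jointE, mul_add, Finset.sum_add_distrib]

theorem jointE_sub (f g : Finset (Fin n) → (Fin n → Fin B) → ℝ) :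
    P.jointE x (fun R φ => f R φ - g R φ) = P.jointE x f - P.jointE x g := by
  simp only [jointE, mul_sub, Finset.sum_sub_distrib]

theorem jointE_const_mul (a : ℝ) (f : Finset (Fin n) → (Fin n → Fin B) → ℝ) :
    P.jointE x (fun R φ => a * f R φ) = a * P.jointE x f := by
  simp only [jointE, Finset.mul_sum]
  exact Finset.sum_congr rfl fun s _ => Finset.sum_congr rfl fun φ _ => by ring

theorem jointE_sum {ι : Type*} (s : Finset ι) (f : ι → Finset (Fin n) → (Fin n → Fin B) → ℝ) :
    P.jointE x (fun R φ => ∑ i ∈ s, f i R φ) = ∑ i ∈ s, P.jointE x (f i) := by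
  classical
  induction s using Finset.induction_on with
  | empty => simpa using jointE_const (P := P) (x := x) 0
  | insert i s hi ih => simp only [Finset.sum_insert hi, jointE_add, ih]

theorem jointE_mono (h0 : ∀ i, 0 ≤ x i) (h1 : ∀ i, x i ≤ 1)
    {f g : Finset (Fin n) → (Fin n → Fin B) → ℝ} (h : ∀ R φ, f R φ ≤ g R φ) :
    P.jointE x f ≤ P.jointE x g :=
  Finset.sum_le_sum fun R _ => Finset.sum_le_sum fun φ _ =>
    mul_le_mul_of_nonneg_left (h R φ) (mul_nonneg (inclusionProb_nonneg h0 h1 R) (P.prob_nonneg φ))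

theorem jointE_eq_set (f : Finset (Fin n) → (Fin n → Fin B) → ℝ) :
    P.jointE x f = ∑ R, inclusionProb x R * ∑ φ, P.prob φ * f R φ := by
  simp only [jointE, Finset.mul_sum, mul_assoc]

theorem jointE_eq_state (f : Finset (Fin n) → (Fin n → Fin B) → ℝ) :
    P.jointE x f = ∑ φ, P.prob φ * ∑ R, inclusionProb x R * f R φ := by
  rw [jointE, Finset.sum_comm]
  simp only [Finset.mul_sum]
  exact Finset.sum_congr rfl fun s _ => Finset.sum_congr rfl fun φ _ => by ring

theorem jointE_set (f : Finset (Fin n) → ℝ) :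
    P.jointE x (fun R _ => f R) = ∑ R, inclusionProb x R * f R := by
  simp only [jointE_eq_set, ← Finset.sum_mul, P.sum_prob, one_mul]

theorem jointE_resample (i : Fin n) (f : Finset (Fin n) → (Fin n → Fin B) → ℝ) :
    P.jointE x f = ∑ s, P.p i s * P.jointE x fun R φ => f R (Function.update φ i s) := by
  simp only [jointE_eq_state]
  exact P.sum_prob_mul_resample i _

theorem jointE_mem (i : Fin n) (f : Finset (Fin n) → (Fin n → Fin B) → ℝ) :
    P.jointE x (fun R φ => if i ∈ R then f R φ else 0) =
      x i * P.jointE x fun R φ => f (insert i R) φ := by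
  simp only [jointE_eq_state, sum_inclusionProb_mem, Finset.mul_sum]
  exact Finset.sum_congr rfl fun s _ => Finset.sum_congr rfl fun φ _ => by ring

/-- Harris' inequality for the random set and the realization. -/
theorem jointE_mul_le_of_nonneg (h0 : ∀ i, 0 ≤ x i) (h1 : ∀ i, x i ≤ 1)
    {f g : Finset (Fin n) → (Fin n → Fin B) → ℝ} (hf0 : ∀ R φ, 0 ≤ f R φ) (hg0 : ∀ R φ, 0 ≤ g R φ)
    (hf : ∀ R R' φ φ', R ⊆ R' → φ ≤ φ' → f R' φ' ≤ f R φ)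
    (hg : ∀ R R' φ φ', R ⊆ R' → φ ≤ φ' → g R' φ' ≤ g R φ) :
    P.jointE x f * P.jointE x g ≤ P.jointE x fun R φ => f R φ * g R φ := by
  -- `fkg` is for monotone functions; the antitone ones here are monotone on the order dual.
  have key := fkg (α := (Finset (Fin n) × (Fin n → Fin B))ᵒᵈ) (β := ℝ)
    (μ := fun q => inclusionProb x (OrderDual.ofDual q).1 * P.prob (OrderDual.ofDual q).2)
    (f := fun q => f (OrderDual.ofDual q).1 (OrderDual.ofDual q).2)
    (g := fun q => g (OrderDual.ofDual q).1 (OrderDual.ofDual q).2)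
    (fun q => mul_nonneg (inclusionProb_nonneg h0 h1 _) (P.prob_nonneg _))
    (fun q => hf0 _ _) (fun q => hg0 _ _)
    (fun q q' h => hf _ _ _ _ h.1 h.2) (fun q q' h => hg _ _ _ _ h.1 h.2)
    (fun q q' => le_of_eq ?_)
  · have conv : ∀ h : Finset (Fin n) × (Fin n → Fin B) → ℝ,
        ∑ q : (Finset (Fin n) × (Fin n → Fin B))ᵒᵈ, h (OrderDual.ofDual q) =
          ∑ R, ∑ φ, h (R, φ) := fun h => by
      rw [← Fintype.sum_prod_type]
      exact Equiv.sum_comp OrderDual.ofDual h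
    have h1' := conv fun q => inclusionProb x q.1 * P.prob q.2
    have h2' := conv fun q => inclusionProb x q.1 * P.prob q.2 * f q.1 q.2
    have h3' := conv fun q => inclusionProb x q.1 * P.prob q.2 * g q.1 q.2
    have h4' := conv fun q => inclusionProb x q.1 * P.prob q.2 * (f q.1 q.2 * g q.1 q.2)
    have h5' : ∑ R, ∑ φ, inclusionProb x R * P.prob φ = 1 := by
      simpa [jointE] using jointE_const (P := P) (x := x) 1
    rw [h1', h2', h3', h4', h5', one_mul] at key
    exact key
  · obtain ⟨⟨R, φ⟩, rfl⟩ := OrderDual.toDual.surjective q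
    obtain ⟨⟨S, ψ⟩, rfl⟩ := OrderDual.toDual.surjective q'
    change inclusionProb x R * P.prob φ * (inclusionProb x S * P.prob ψ) =
      inclusionProb x (R ∪ S) * P.prob (φ ⊔ ψ) * (inclusionProb x (R ∩ S) * P.prob (φ ⊓ ψ))
    have e1 := inclusionProb_mul_inclusionProb x R S
    have e2 := P.prob_mul_prob φ ψ
    calc _ = (inclusionProb x R * inclusionProb x S) * (P.prob φ * P.prob ψ) := by ring
      _ = _ := by rw [e1, e2]; ring

/-- Adding a large constant to `g` changes both sides by the same multiple of the expectation of
`f`, so only `f` has to be nonnegative. This matters because the Markov bound `avgSlack` can be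
negative. -/
theorem jointE_mul_le (h0 : ∀ i, 0 ≤ x i) (h1 : ∀ i, x i ≤ 1)
    {f g : Finset (Fin n) → (Fin n → Fin B) → ℝ} (hf0 : ∀ R φ, 0 ≤ f R φ)
    (hf : ∀ R R' φ φ', R ⊆ R' → φ ≤ φ' → f R' φ' ≤ f R φ)
    (hg : ∀ R R' φ φ', R ⊆ R' → φ ≤ φ' → g R' φ' ≤ g R φ) :
    P.jointE x f * P.jointE x g ≤ P.jointE x fun R φ => f R φ * g R φ := by
  set K : ℝ := ∑ R, ∑ φ, |g R φ| with hK
  have hle : ∀ R φ, |g R φ| ≤ K := fun R φ =>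
    (Finset.single_le_sum (fun φ _ => abs_nonneg (g R φ)) (Finset.mem_univ φ)).trans
      (Finset.single_le_sum (f := fun R => ∑ φ, |g R φ|)
        (fun R _ => Finset.sum_nonneg fun φ _ => abs_nonneg (g R φ)) (Finset.mem_univ R))
  have key := jointE_mul_le_of_nonneg (P := P) h0 h1 hf0 (g := fun R φ => g R φ + K)
    (fun R φ => by linarith [neg_abs_le (g R φ), hle R φ]) hf
    (fun R R' φ φ' hR hφ => by linarith [hg R R' φ φ' hR hφ])
  have e : (fun R φ => f R φ * (g R φ + K)) = fun R φ => f R φ * g R φ + K * f R φ := by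
    funext R φ; ring
  rw [e, jointE_add, jointE_add, jointE_const, jointE_const_mul] at key
  linarith

end Problem

/-! ### Restricted realizations and lattice submodularity. -/

section Lattice

variable {n B : ℕ}

theorem restrictTo_insert (φ : Fin n → Fin B) (i : Fin n) (A : Finset (Fin n)) :
    restrictTo φ (insert i A) = restrictTo φ A ⊔ Pi.single i (φ i).succ := by
  funext j
  by_cases hj : j = i
  · subst hj
    by_cases h : j ∈ A <;> simp [restrictTo, h]
  · simp [restrictTo, hj]

theorem restrictTo_update_insert (φ : Fin n → Fin B) (i : Fin n) (s : Fin B)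
    (A : Finset (Fin n)) :
    restrictTo (Function.update φ i s) (insert i A) =
      restrictTo φ (A.erase i) ⊔ Pi.single i s.succ := by
  funext j
  by_cases hj : j = i
  · subst hj; simp [restrictTo]
  · simp [restrictTo, hj]

theorem restrictTo_congr {φ ψ : Fin n → Fin B} {A : Finset (Fin n)} (h : ∀ i ∈ A, φ i = ψ i) :
    restrictTo φ A = restrictTo ψ A := by
  funext i
  by_cases hi : i ∈ A
  · simp [restrictTo, hi, h i hi]
  · simp [restrictTo, hi]

theorem restrictTo_update_of_notMem (φ : Fin n → Fin B) {i : Fin n} (s : Fin B)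
    {A : Finset (Fin n)} (hi : i ∉ A) : restrictTo (Function.update φ i s) A = restrictTo φ A :=
  restrictTo_congr fun j hj => Function.update_of_ne (by rintro rfl; exact hi hj) _ _

theorem restrictTo_mono {φ ψ : Fin n → Fin B} {A A' : Finset (Fin n)} (hφ : φ ≤ ψ)
    (hA : A ⊆ A') : restrictTo φ A ≤ restrictTo ψ A' := by
  intro i
  by_cases hi : i ∈ A
  · simpa [restrictTo, hi, hA hi] using hφ i
  · simp [restrictTo, hi]

@[simp]
theorem restrictTo_empty (φ : Fin n → Fin B) : restrictTo φ ∅ = 0 := by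
  funext i; simp [restrictTo]

/-- A lattice-submodular function gains from a union at most the sum of the single gains. -/
theorem LatticeSubmodular.sup_restrictTo_le {f : (Fin n → Fin (B + 1)) → ℝ}
    (hf : LatticeSubmodular f) (φ : Fin n → Fin B) (v : Fin n → Fin (B + 1))
    (u : Fin n → Fin n → Fin (B + 1)) (hu : ∀ i, u i ≤ v) (A : Finset (Fin n)) :
    f (v ⊔ restrictTo φ A) ≤
      f v + ∑ i ∈ A, (f (u i ⊔ Pi.single i (φ i).succ) - f (u i)) := by
  induction A using Finset.induction_on with
  | empty =>
    have : v ⊔ (0 : Fin n → Fin (B + 1)) = v := sup_eq_left.2 fun i => Fin.zero_le _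
    simp [this]
  | insert i A hi ih =>
    rw [Finset.sum_insert hi, restrictTo_insert, ← sup_assoc]
    linarith [hf (u i) (v ⊔ restrictTo φ A) ((hu i).trans le_sup_left) i (φ i).succ]

end Lattice

/-! ### Start times of an adaptive policy. -/

namespace Policy

variable {n B : ℕ}

/-- The cost of the items selected before item `i`, in a run that has already selected `A`; it is `⊤`
if `i` is not selected any more. -/
def start (c : Fin n → Fin B → ℕ) :
    Policy n B → (Fin n → Fin B) → Finset (Fin n) → Fin n → ℕ∞
  | .halt, _, _, _ => ⊤
  | .select j next, φ, A, i =>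
    if j = i then ((∑ k ∈ A, c k (φ k) : ℕ) : ℕ∞)
    else (next (φ j)).start c φ (insert j A) i

variable (c : Fin n → Fin B → ℕ)

theorem start_ne_top_iff (π : Policy n B) (φ : Fin n → Fin B) (A : Finset (Fin n)) (i : Fin n) :
    π.start c φ A i ≠ ⊤ ↔ i ∈ π.selected φ := by
  induction π generalizing A with
  | halt => simp [start, selected]
  | select j next ih =>
    by_cases h : j = i
    · subst h; simp [start, selected, -Nat.cast_sum]
    · simp [start, selected, h, ih, Ne.symm h]

/-- An item is selected before its state is seen, so its own state cannot influence when it starts.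
Every independence claim about policies rests on this. -/
theorem start_update (π : Policy n B) (φ : Fin n → Fin B) {A : Finset (Fin n)} {i : Fin n}
    (hi : i ∉ A) (s : Fin B) : π.start c (Function.update φ i s) A i = π.start c φ A i := by
  induction π generalizing A with
  | halt => rfl
  | select j next ih =>
    by_cases h : j = i
    · simp only [start, h, if_true]
      congr 1
      exact Finset.sum_congr rfl fun k hk => by
        rw [Function.update_of_ne (by rintro rfl; exact hi hk)]
    · simp only [start, h, if_false, Function.update_of_ne h]
      exact ih _ (by simp [hi, Ne.symm h])

theorem le_start (π : Policy n B) (φ : Fin n → Fin B) (A : Finset (Fin n)) {i : Fin n}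
    (hi : i ∉ A) : ((∑ k ∈ A, c k (φ k) : ℕ) : ℕ∞) ≤ π.start c φ A i := by
  induction π generalizing A with
  | halt => exact le_top
  | select j next ih =>
    by_cases h : j = i
    · simp only [start, h, if_true, le_refl]
    · simp only [start, h, if_false]
      refine le_trans ?_ (ih _ (insert j A) (by simp [hi, Ne.symm h]))
      exact Nat.cast_le.2 (Finset.sum_le_sum_of_subset (Finset.subset_insert _ _))

theorem start_add_cost_le (π : Policy n B) (φ : Fin n → Fin B) {A : Finset (Fin n)} {i : Fin n}
    (hi : i ∉ A) {a : ℕ} (ha : π.start c φ A i = a) :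
    a + c i (φ i) ≤ ∑ k ∈ A ∪ π.selected φ, c k (φ k) := by
  induction π generalizing A with
  | halt => simp [start] at ha
  | select j next ih =>
    by_cases h : j = i
    · subst h
      simp only [start, if_true, Nat.cast_inj] at ha
      rw [← ha, add_comm, ← Finset.sum_insert (f := fun k => c k (φ k)) hi]
      refine Finset.sum_le_sum_of_subset (Finset.insert_subset ?_ Finset.subset_union_left)
      simp [selected]
    · simp only [start, h, if_false] at ha
      refine (ih _ (by simp [hi, Ne.symm h]) ha).trans (Finset.sum_le_sum_of_subset ?_)
      intro k; simp [selected]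

/-- The items started by time `t` have total cost at most `2 t`, if the cost of each is truncated
at `t`. -/
theorem sum_min_cost_start_le (π : Policy n B) (φ : Fin n → Fin B) (t : ℕ)
    {A : Finset (Fin n)} (hA : ∑ k ∈ A, c k (φ k) ≤ t) :
    (∑ i ∈ Aᶜ, if π.start c φ A i ≤ t then min (c i (φ i)) t else 0) + ∑ k ∈ A, c k (φ k) ≤
      2 * t := by
  induction π generalizing A with
  | halt => simp [start]; omega
  | select j next ih =>
    -- A decision tree may name an item again; then neither the selected set nor its cost changes.
    by_cases hj : j ∈ A
    · have hins : insert j A = A := Finset.insert_eq_of_mem hj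
      rw [Finset.sum_congr rfl fun i hi => ?_]
      · exact ih (φ j) hA
      · have : j ≠ i := fun e => (Finset.mem_compl.1 hi) (e ▸ hj)
        simp only [start, this, if_false, hins]
    · have hjc : j ∈ Aᶜ := Finset.mem_compl.2 hj
      rw [← Finset.add_sum_erase _ _ hjc, ← Finset.compl_insert]
      have hle : (((∑ k ∈ A, c k (φ k) : ℕ) : ℕ∞) ≤ t) := Nat.cast_le.2 hA
      rw [Finset.sum_congr rfl fun i hi => show _ =
        if (next (φ j)).start c φ (insert j A) i ≤ t then min (c i (φ i)) t else 0 from ?_]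
      · simp only [start, if_true, hle]
        have hsum := Finset.sum_insert (f := fun k => c k (φ k)) hj
        -- If `j` pushes the cost beyond `t`, every later item starts after `t`. Then `j` is the
        -- last one counted, adding at most `t` to a cost of at most `t`.
        by_cases hc : ∑ k ∈ insert j A, c k (φ k) ≤ t
        · have := ih (φ j) hc
          have := min_le_left (c j (φ j)) t
          omega
        · rw [Finset.sum_eq_zero fun i hi => if_neg fun hlt => hc ?_]
          · have := min_le_right (c j (φ j)) t
            omega
          · exact Nat.cast_le.1 ((le_start c _ φ _ (Finset.mem_compl.1 hi)).trans hlt)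
      · have : j ≠ i := fun e => (Finset.mem_compl.1 hi) (e ▸ Finset.mem_insert_self _ _)
        simp only [start, this, if_false]

end Policy

/-! ### Policies as fractional solutions, and the gradient bound. -/

namespace Problem

variable {n B : ℕ} (P : Problem n B)

theorem gradF_eq (x : Fin n → ℝ) (i : Fin n) :
    P.gradF x i =
      ∑ R, inclusionProb x R * (P.fbar (insert i R) - P.fbar (R.erase i)) := by
  simp only [gradF, F, sum_inclusionProb_update, mul_sub, Finset.sum_sub_distrib]
  ring

theorem F_eq_jointE (x : Fin n → ℝ) :
    P.F x = P.jointE x fun R φ => P.f (restrictTo φ R) := by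
  rw [jointE_eq_set]; rfl

/-- The expected gain of raising item `i` to a random level, on top of the other items. -/
theorem sum_jointE_gain (x : Fin n → ℝ) (i : Fin n) :
    ∑ s, P.p i s * P.jointE x (fun R φ =>
      P.f (restrictTo (Function.update φ i s) (insert i R)) - P.f (restrictTo φ (R.erase i))) =
      P.gradF x i := by
  have h := jointE_resample (P := P) (x := x) i fun R φ =>
    P.f (restrictTo φ (insert i R)) - P.f (restrictTo φ (R.erase i))
  simp only [restrictTo_update_of_notMem _ _ (Finset.notMem_erase i _)] at h
  rw [← h, gradF_eq, jointE_eq_set]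
  simp only [fbar, mul_sub, Finset.sum_sub_distrib]

theorem sum_prob_selected_mul (π : Policy n B) (i : Fin n) (h : Fin B → ℝ) :
    ∑ φ, P.prob φ * ((if i ∈ π.selected φ then 1 else 0) * h (φ i)) =
      (∑ φ, P.prob φ * if i ∈ π.selected φ then 1 else 0) * ∑ s, P.p i s * h s := by
  refine P.sum_prob_mul_indep i _ h fun φ s => ?_
  simp only [← Policy.start_ne_top_iff P.c π _ ∅,
    Policy.start_update P.c π φ (Finset.notMem_empty i) s]

/-- The gap between a policy and the multilinear extension is at most the expected gradient along the
items selected by the policy. -/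
theorem favg_sub_F_le (hf : Monotone P.f) (hs : LatticeSubmodular P.f) (π : Policy n B)
    {x : Fin n → ℝ} (h0 : ∀ i, 0 ≤ x i) (h1 : ∀ i, x i ≤ 1) :
    P.favg π - P.F x ≤
      ∑ i, P.gradF x i * ∑ φ, P.prob φ * if i ∈ π.selected φ then 1 else 0 := by
  set gain : Fin n → Fin B → ℝ := fun i s => P.jointE x (fun R φ =>
      P.f (restrictTo (Function.update φ i s) (insert i R)) - P.f (restrictTo φ (R.erase i)))
    with hgain
  have hpt : ∀ φ, P.f (restrictTo φ (π.selected φ)) ≤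
      P.F x + ∑ i, (if i ∈ π.selected φ then 1 else 0) * gain i (φ i) := by
    intro φ
    have e : P.F x + ∑ i, (if i ∈ π.selected φ then 1 else 0) * gain i (φ i) =
        P.jointE x fun R ψ => P.f (restrictTo ψ R) + ∑ i ∈ π.selected φ,
          (P.f (restrictTo (Function.update ψ i (φ i)) (insert i R)) -
            P.f (restrictTo ψ (R.erase i))) := by
      rw [jointE_add, ← F_eq_jointE, jointE_sum]
      simp [hgain]
    -- Compare pointwise for an independent set `R` and realization `ψ`: pass from the items of `π`
    -- to their join with `restrictTo ψ R`. The gain of `i` is measured over `R.erase i`, so that it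
    -- does not involve the state of `i` in `ψ`.
    rw [e, ← jointE_const (P := P) (x := x) (P.f (restrictTo φ (π.selected φ)))]
    refine jointE_mono h0 h1 fun R ψ => ?_
    simp only [restrictTo_update_insert]
    exact (hf le_sup_right).trans (hs.sup_restrictTo_le φ (restrictTo ψ R)
      (fun i => restrictTo ψ (R.erase i))
      (fun i => restrictTo_mono le_rfl (Finset.erase_subset _ _)) _)
  have hsum : P.favg π ≤ ∑ φ, P.prob φ *
      (P.F x + ∑ i, (if i ∈ π.selected φ then 1 else 0) * gain i (φ i)) :=
    Finset.sum_le_sum fun φ _ => mul_le_mul_of_nonneg_left (hpt φ) (P.prob_nonneg φ)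
  simp only [mul_add, Finset.sum_add_distrib, ← Finset.sum_mul, P.sum_prob, one_mul,
    Finset.mul_sum] at hsum
  rw [Finset.sum_comm] at hsum
  have : ∀ i, ∑ φ, P.prob φ * ((if i ∈ π.selected φ then 1 else 0) * gain i (φ i)) =
      P.gradF x i * ∑ φ, P.prob φ * if i ∈ π.selected φ then 1 else 0 := fun i => by
    rw [P.sum_prob_selected_mul π i (gain i), P.sum_jointE_gain x i, mul_comm]
  simp only [this] at hsum
  linarith

theorem bounds_of_mem_slots {t₀ : ℕ} {i : Fin n} {t : ℕ} (ht : t ∈ P.slots t₀ i) :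
    t₀ ≤ t ∧ t ≤ P.C ∧ ∀ s, t + P.c i s ≤ P.C := by
  simpa [slots, and_assoc] using ht

/-- The probability that a policy starts item `i` in slot `t`, if time slots are numbered from `t₀`. -/
noncomputable def slotProb (t₀ : ℕ) (π : Policy n B) (i : Fin n) (t : ℕ) : ℝ :=
  ∑ φ, P.prob φ * if max (π.start P.c φ ∅ i) t₀ = t then 1 else 0

/-- The start does not depend on the state of `i`, and the budget holds for every realization, so
even the costliest state of `i` fits after it. `hC` is needed when a start at cost 0 is moved up to
slot `t₀ = 1`. -/
theorem mem_slots_of_start {t₀ : ℕ}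
    (hC : ∀ i, (∀ s, P.c i s ≤ P.C) → ∀ s, t₀ + P.c i s ≤ P.C) {π : Policy n B}
    (hπ : P.Feasible π) {i : Fin n} {t : ℕ} {φ : Fin n → Fin B}
    (h : max (π.start P.c φ ∅ i) t₀ = t) : t ∈ P.slots t₀ i := by
  obtain ⟨a, ha⟩ : ∃ a : ℕ, π.start P.c φ ∅ i = a := by
    obtain ⟨a, ha⟩ := ENat.ne_top_iff_exists.1 (fun e : π.start P.c φ ∅ i = ⊤ => by
      rw [e] at h; simp at h)
    exact ⟨a, ha.symm⟩
  have hcost : ∀ s, a + P.c i s ≤ P.C := fun s => by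
    have hu := Policy.start_update P.c π φ (Finset.notMem_empty i) s
    have := Policy.start_add_cost_le P.c π (Function.update φ i s) (Finset.notMem_empty i)
      (hu.trans ha)
    rw [Finset.empty_union, Function.update_self] at this
    exact this.trans (hπ.1 _)
  rw [ha] at h
  have e : ((max a t₀ : ℕ) : ℕ∞) = max (a : ℕ∞) t₀ := by norm_cast
  have hm : max a t₀ = t := Nat.cast_inj.1 (e.trans h)
  have hcost' : ∀ s, t + P.c i s ≤ P.C := fun s => by
    by_cases hat : t₀ ≤ a
    · rw [max_eq_left hat] at hm; rw [← hm]; exact hcost s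
    · rw [max_eq_right (by omega)] at hm
      rw [← hm]
      exact hC i (fun s => (Nat.le_add_left _ _).trans (hcost s)) s
  simp only [slots, Finset.mem_filter, Finset.mem_Icc]
  exact ⟨⟨hm ▸ le_max_right _ _, (Nat.le_add_right _ _).trans (hcost' (φ i))⟩, hcost'⟩

theorem sum_slotProb (t₀ : ℕ) (π : Policy n B) (i : Fin n) (T : Finset ℕ) :
    ∑ t ∈ T, P.slotProb t₀ π i t =
      ∑ φ, P.prob φ * if ∃ t ∈ T, max (π.start P.c φ ∅ i) t₀ = (t : ℕ∞) then 1 else 0 := by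
  unfold slotProb
  rw [Finset.sum_comm]
  refine Finset.sum_congr rfl fun φ _ => ?_
  rw [← Finset.mul_sum]
  congr 1
  split_ifs with h
  · obtain ⟨t, ht, e⟩ := h
    rw [e, Finset.sum_eq_single_of_mem t ht fun t' _ hne => if_neg fun e => hne (by
      exact_mod_cast e.symm), if_pos rfl]
  · exact Finset.sum_eq_zero fun t ht => if_neg fun e => h ⟨t, ht, e⟩

theorem bar_slotProb {t₀ : ℕ}
    (hC : ∀ i, (∀ s, P.c i s ≤ P.C) → ∀ s, t₀ + P.c i s ≤ P.C) {π : Policy n B}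
    (hπ : P.Feasible π) (i : Fin n) :
    P.bar t₀ (P.slotProb t₀ π) i = ∑ φ, P.prob φ * if i ∈ π.selected φ then 1 else 0 := by
  rw [bar, sum_slotProb]
  refine Finset.sum_congr rfl fun φ _ => ?_
  congr 1
  refine if_congr ?_ rfl rfl
  rw [← Policy.start_ne_top_iff P.c π φ ∅ i]
  constructor
  · rintro ⟨t, -, e⟩ h
    rw [h] at e
    simp at e
  · intro h
    obtain ⟨a, ha⟩ := ENat.ne_top_iff_exists.1 h
    have e : max (π.start P.c φ ∅ i) t₀ = ((max a t₀ : ℕ) : ℕ∞) := by rw [← ha]; norm_cast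
    exact ⟨max a t₀, P.mem_slots_of_start hC hπ e, e⟩

/-- The start times of a feasible policy give a feasible solution of the continuous problem. -/
theorem isFractional_slotProb {t₀ : ℕ} (ht₀ : t₀ ≤ 1)
    (hC : ∀ i, (∀ s, P.c i s ≤ P.C) → ∀ s, t₀ + P.c i s ≤ P.C) {π : Policy n B}
    (hπ : P.Feasible π) : P.IsFractional t₀ (P.slotProb t₀ π) where
  nonneg i t := Finset.sum_nonneg fun φ _ => mul_nonneg (P.prob_nonneg φ) (by positivity)
  eq_zero i t ht := Finset.sum_eq_zero fun φ _ => by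
    rw [if_neg fun e => ht (P.mem_slots_of_start hC hπ e), mul_zero]
  bar_le_one i := by
    rw [P.bar_slotProb hC hπ]
    refine le_trans ?_ P.sum_prob.le
    exact Finset.sum_le_sum fun φ _ => mul_le_of_le_one_right (P.prob_nonneg φ) (by
      split_ifs <;> norm_num)
  bar_mem := by
    have e : P.bar t₀ (P.slotProb t₀ π) = ∑ φ : Fin n → Fin B, P.prob φ •
        fun i => if i ∈ π.selected φ then (1 : ℝ) else 0 := by
      funext i
      rw [P.bar_slotProb hC hπ]
      simp
    rw [e]
    exact (convex_convexHull ℝ _).sum_mem (fun φ _ => P.prob_nonneg φ) P.sum_prob fun φ _ =>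
      subset_convexHull ℝ _ ⟨_, hπ.2 φ, rfl⟩
  knapsack t ht := by
    have ht1 : 1 ≤ t := (Finset.mem_Icc.1 ht).1
    have hstart : ∀ i, P.truncCost i t * ∑ t' ∈ Finset.Icc t₀ t, P.slotProb t₀ π i t' =
        ∑ φ, P.prob φ *
          -- Starting by time `t` is independent of the state of `i`, so the expected truncated cost
          -- factors out.
          ((if π.start P.c φ ∅ i ≤ t then 1 else 0) * (min (P.c i (φ i)) t : ℕ)) := fun i => by
      rw [P.sum_prob_mul_indep i (fun φ => if π.start P.c φ ∅ i ≤ t then 1 else 0)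
        (fun s => (min (P.c i s) t : ℕ)), mul_comm, sum_slotProb]
      · congr 1
        refine Finset.sum_congr rfl fun φ _ => ?_
        congr 1
        refine if_congr ?_ rfl rfl
        constructor
        · rintro ⟨t', ht', e⟩
          exact (le_max_left _ _).trans (e.le.trans (Nat.cast_le.2 (Finset.mem_Icc.1 ht').2))
        · intro h
          obtain ⟨a, ha⟩ := ENat.ne_top_iff_exists.1 (ne_top_of_le_ne_top (ENat.natCast_ne_top t) h)
          rw [← ha] at h ⊢
          have hat : a ≤ t := by exact_mod_cast h
          -- The rounded-up start stays within `t` because `t₀ ≤ 1 ≤ t`.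
          exact ⟨max a t₀, Finset.mem_Icc.2 ⟨le_max_right _ _, max_le hat (by omega)⟩, by
            norm_cast⟩
      · intro φ s
        simp only [Policy.start_update P.c π φ (Finset.notMem_empty i) s]
    simp only [hstart]
    rw [Finset.sum_comm]
    simp only [← Finset.mul_sum]
    calc _ ≤ ∑ φ, P.prob φ * (2 * (t : ℝ)) := by
          refine Finset.sum_le_sum fun φ _ => mul_le_mul_of_nonneg_left ?_ (P.prob_nonneg φ)
          have h := Policy.sum_min_cost_start_le P.c π φ t (A := ∅) (by simp)
          simp only [Finset.compl_empty, Finset.sum_empty, add_zero] at h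
          have h' : ((∑ i, if π.start P.c φ ∅ i ≤ t then min (P.c i (φ i)) t else 0 : ℕ) : ℝ) ≤
              2 * t := by exact_mod_cast h
          refine le_trans (le_of_eq ?_) h'
          push_cast
          exact Finset.sum_congr rfl fun i _ => by split_ifs <;> simp
      _ = 2 * (t : ℝ) := by rw [← Finset.sum_mul, P.sum_prob, one_mul]

end Problem

/-! ### Continuous greedy. -/

namespace Problem

variable {n B : ℕ} (P : Problem n B)

theorem empty_mem_Iout : ∅ ∈ P.Iout :=
  let ⟨_, hS⟩ := P.Iout_nonempty
  P.Iout_lower (Finset.empty_subset _) hS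

theorem zero_mem_familyPolytope : (0 : Fin n → ℝ) ∈ familyPolytope P.Iout :=
  subset_convexHull ℝ _ ⟨∅, P.empty_mem_Iout, by funext; simp⟩

theorem convex_familyPolytope (F : Set (Finset (Fin n))) : Convex ℝ (familyPolytope F) :=
  convex_convexHull ℝ _

/-- The polytope is convex and contains the origin. Hence a scheme for `β` also covers the output at
a stopping time below `β`. -/
theorem smul_familyPolytope_subset {a b : ℝ} (ha : 0 ≤ a) (hab : a ≤ b) :
    a • familyPolytope P.Iout ⊆ b • familyPolytope P.Iout := by
  rintro _ ⟨v, hv, rfl⟩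
  rcases (ha.trans hab).eq_or_lt with h | h
  · have : a = b := by linarith
    exact this ▸ Set.smul_mem_smul_set hv
  · refine ⟨(a / b) • v, (convex_familyPolytope _).smul_mem_of_zero_mem
      P.zero_mem_familyPolytope hv ⟨by positivity, (div_le_one h).2 hab⟩, ?_⟩
    change b • (a / b) • v = a • v
    rw [smul_smul, mul_div_cancel₀ _ h.ne']

theorem isClosed_familyPolytope (F : Set (Finset (Fin n))) : IsClosed (familyPolytope F) :=
  ((Set.toFinite F).image _).isCompact_convexHull ℝ |>.isClosed

theorem bar_zero (t₀ : ℕ) : P.bar t₀ 0 = 0 := by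
  funext i; simp [bar]

theorem bar_add_smul (t₀ : ℕ) (h : ℝ) (x v : Fin n → ℕ → ℝ) :
    P.bar t₀ (x + h • v) = P.bar t₀ x + h • P.bar t₀ v := by
  funext i
  simp [bar, Finset.sum_add_distrib, Finset.mul_sum]

theorem isFractional_zero (t₀ : ℕ) : P.IsFractional t₀ 0 where
  nonneg _ _ := le_rfl
  eq_zero _ _ _ := rfl
  bar_le_one i := by simp [bar]
  bar_mem := by rw [bar_zero]; exact P.zero_mem_familyPolytope
  knapsack t _ := by simp

variable {P} in
theorem IsFractional.le_one {t₀ : ℕ} {v : Fin n → ℕ → ℝ} (hv : P.IsFractional t₀ v) (i : Fin n)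
    (t : ℕ) : v i t ≤ 1 := by
  by_cases ht : t ∈ P.slots t₀ i
  · exact (Finset.single_le_sum (f := v i) (fun t _ => hv.nonneg i t) ht).trans (hv.bar_le_one i)
  · rw [hv.eq_zero i t ht]; exact zero_le_one

/-- A closed subset of a cube, compact by Tychonoff since times range over all of `ℕ`. This supplies
the maximizer for each greedy step. -/
theorem isCompact_setOf_isFractional (t₀ : ℕ) : IsCompact {v | P.IsFractional t₀ v} := by
  have hK : IsCompact (Set.univ.pi fun _ : Fin n => Set.univ.pi fun _ : ℕ => Set.Icc (0 : ℝ) 1) :=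
    isCompact_univ_pi fun _ => isCompact_univ_pi fun _ => isCompact_Icc
  refine hK.of_isClosed_subset ?_ fun v hv i _ t _ => ⟨hv.nonneg i t, hv.le_one i t⟩
  have hcont : ∀ i, Continuous fun v : Fin n → ℕ → ℝ => P.bar t₀ v i := fun i => by
    unfold bar; fun_prop
  have e : {v | P.IsFractional t₀ v} =
      {v | ∀ i t, 0 ≤ v i t} ∩ {v | ∀ i, ∀ t ∉ P.slots t₀ i, v i t = 0} ∩
      {v | ∀ i, P.bar t₀ v i ≤ 1} ∩ (P.bar t₀ ⁻¹' familyPolytope P.Iout) ∩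
      {v | ∀ t ∈ Finset.Icc 1 P.C,
        ∑ i, P.truncCost i t * ∑ t' ∈ Finset.Icc t₀ t, v i t' ≤ 2 * (t : ℝ)} := by
    ext v
    exact ⟨fun h => ⟨⟨⟨⟨h.1, h.2⟩, h.3⟩, h.4⟩, h.5⟩, fun h =>
      ⟨h.1.1.1.1, h.1.1.1.2, h.1.1.2, h.1.2, h.2⟩⟩
  rw [e]
  simp only [Set.ofPred_forall]
  refine ((((?_ : IsClosed _).inter ?_).inter ?_).inter
    ((isClosed_familyPolytope _).preimage (continuous_pi hcont))).inter ?_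
  · exact isClosed_iInter fun i => isClosed_iInter fun t =>
      isClosed_le continuous_const (by fun_prop)
  · exact isClosed_iInter fun i => isClosed_iInter fun t => isClosed_iInter fun _ =>
      isClosed_eq (by fun_prop) continuous_const
  · exact isClosed_iInter fun i => isClosed_le (hcont i) continuous_const
  · exact isClosed_iInter fun t => isClosed_iInter fun _ =>
      isClosed_le (by fun_prop) continuous_const

theorem exists_isFractional_forall_le (t₀ : ℕ) (w : Fin n → ℝ) :
    ∃ v, P.IsFractional t₀ v ∧ ∀ u, P.IsFractional t₀ u →
      ∑ i, w i * P.bar t₀ u i ≤ ∑ i, w i * P.bar t₀ v i := by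
  have hcont : Continuous fun v : Fin n → ℕ → ℝ => ∑ i, w i * P.bar t₀ v i := by
    unfold bar; fun_prop
  obtain ⟨v, hv, hmax⟩ := (P.isCompact_setOf_isFractional t₀).exists_isMaxOn
    ⟨0, P.isFractional_zero t₀⟩ hcont.continuousOn
  exact ⟨v, hv, fun u hu => hmax hu⟩

theorem exists_isGreedyOutput (t₀ : ℕ) (l δ : ℝ) : ∃ y, P.IsGreedyOutput t₀ l δ y := by
  choose v hv hmax using fun y : Fin n → ℕ → ℝ =>
    P.exists_isFractional_forall_le t₀ (P.gradF (P.bar t₀ y))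
  let Y : ℕ → Fin n → ℕ → ℝ := fun k =>
    Nat.rec 0 (fun k y => y + min δ (l - k * δ) • v y) k
  exact ⟨_, Y, rfl, rfl, fun k _ => ⟨v (Y k), hv _, hmax _, rfl⟩⟩

/-- The properties of a combination of fractional solutions with total weight `θ`. -/
structure IsScaledFractional (t₀ : ℕ) (θ : ℝ) (y : Fin n → ℕ → ℝ) : Prop where
  nonneg : ∀ i t, 0 ≤ y i t
  eq_zero : ∀ i, ∀ t ∉ P.slots t₀ i, y i t = 0
  bar_le : ∀ i, P.bar t₀ y i ≤ θ
  bar_mem : P.bar t₀ y ∈ θ • familyPolytope P.Iout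
  knapsack : ∀ t ∈ Finset.Icc 1 P.C,
    ∑ i, P.truncCost i t * ∑ t' ∈ Finset.Icc t₀ t, y i t' ≤ θ * (2 * (t : ℝ))

variable {P} in
theorem IsScaledFractional.bar_nonneg {t₀ : ℕ} {θ : ℝ} {y : Fin n → ℕ → ℝ}
    (hy : P.IsScaledFractional t₀ θ y) (i : Fin n) : 0 ≤ P.bar t₀ y i :=
  Finset.sum_nonneg fun t _ => hy.nonneg i t

theorem isScaledFractional_zero (t₀ : ℕ) : P.IsScaledFractional t₀ 0 0 where
  nonneg _ _ := le_rfl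
  eq_zero _ _ _ := rfl
  bar_le i := by simp [bar]
  bar_mem := ⟨0, P.zero_mem_familyPolytope, by rw [bar_zero]; simp⟩
  knapsack t _ := by simp

variable {P} in
theorem IsScaledFractional.add_smul {t₀ : ℕ} {θ h : ℝ} {y v : Fin n → ℕ → ℝ} (hθ : 0 ≤ θ)
    (hh : 0 ≤ h) (hy : P.IsScaledFractional t₀ θ y) (hv : P.IsFractional t₀ v) :
    P.IsScaledFractional t₀ (θ + h) (y + h • v) where
  nonneg i t := add_nonneg (hy.nonneg i t) (mul_nonneg hh (hv.nonneg i t))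
  eq_zero i t ht := by simp [hy.eq_zero i t ht, hv.eq_zero i t ht]
  bar_le i := by
    rw [bar_add_smul]
    exact add_le_add (hy.bar_le i) (mul_le_of_le_one_right hh (hv.bar_le_one i))
  bar_mem := by
    rw [bar_add_smul, (convex_familyPolytope _).add_smul hθ hh]
    exact Set.add_mem_add hy.bar_mem (Set.smul_mem_smul_set hv.bar_mem)
  knapsack t ht := by
    have e : ∑ i, P.truncCost i t * ∑ t' ∈ Finset.Icc t₀ t, (y + h • v) i t' =
        (∑ i, P.truncCost i t * ∑ t' ∈ Finset.Icc t₀ t, y i t') +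
          h * ∑ i, P.truncCost i t * ∑ t' ∈ Finset.Icc t₀ t, v i t' := by
      simp only [Pi.add_apply, Pi.smul_apply, smul_eq_mul, Finset.sum_add_distrib, mul_add,
        ← Finset.mul_sum, mul_left_comm _ h]
    rw [e, add_mul]
    exact add_le_add (hy.knapsack t ht) (mul_le_mul_of_nonneg_left (hv.knapsack t ht) hh)

theorem fbar_mono (hf : Monotone P.f) : Monotone P.fbar := fun _ _ h =>
  Finset.sum_le_sum fun φ _ =>
    mul_le_mul_of_nonneg_left (hf (restrictTo_mono le_rfl h)) (P.prob_nonneg φ)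

theorem fbar_nonneg (S : Finset (Fin n)) : 0 ≤ P.fbar S :=
  Finset.sum_nonneg fun φ _ => mul_nonneg (P.prob_nonneg φ) (P.f_nonneg _)

theorem favg_nonneg (π : Policy n B) : 0 ≤ P.favg π :=
  Finset.sum_nonneg fun φ _ => mul_nonneg (P.prob_nonneg φ) (P.f_nonneg _)

theorem F_nonneg {x : Fin n → ℝ} (h0 : ∀ i, 0 ≤ x i) (h1 : ∀ i, x i ≤ 1) : 0 ≤ P.F x :=
  Finset.sum_nonneg fun U _ => mul_nonneg (inclusionProb_nonneg h0 h1 U) (P.fbar_nonneg U)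

theorem gain_nonneg (hf : Monotone P.f) (i : Fin n) (R : Finset (Fin n)) :
    0 ≤ P.fbar (insert i R) - P.fbar (R.erase i) :=
  sub_nonneg.2 (P.fbar_mono hf ((Finset.erase_subset _ _).trans (Finset.subset_insert _ _)))

theorem F_update (x : Fin n → ℝ) (i : Fin n) (a : ℝ) :
    P.F (Function.update x i a) = P.F x + (a - x i) * P.gradF x i := by
  have h1 := sum_inclusionProb_update x i a P.fbar
  have h2 := sum_inclusionProb_update x i (x i) P.fbar
  rw [Function.update_eq_self] at h2
  simp only [gradF_eq, F, h1, h2, mul_sub, Finset.sum_sub_distrib]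
  ring

/-- For monotone `f` the gradient is a combination of set probabilities with nonnegative
coefficients, so the setwise bound carries over. -/
theorem pow_mul_gradF_le (hf : Monotone P.f) {x y : Fin n → ℝ} {a : ℝ} (ha0 : 0 ≤ a)
    (ha1 : a ≤ 1) (hx0 : ∀ i, 0 ≤ x i) (hx1 : ∀ i, x i ≤ 1) (hxy : ∀ i, x i ≤ y i)
    (hy : ∀ i, a * (1 - x i) ≤ 1 - y i) (i : Fin n) :
    a ^ n * P.gradF x i ≤ P.gradF y i := by
  rw [gradF_eq, gradF_eq, Finset.mul_sum]
  refine Finset.sum_le_sum fun R _ => ?_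
  rw [← mul_assoc]
  exact mul_le_mul_of_nonneg_right (pow_mul_inclusionProb_le ha0 ha1 hx0 hx1 hxy hy R)
    (P.gain_nonneg hf i R)

/-- A step up increases the multilinear extension nearly as much as its linearization. -/
theorem F_add_pow_mul_le (hf : Monotone P.f) {x y : Fin n → ℝ} {a : ℝ} (ha0 : 0 ≤ a)
    (ha1 : a ≤ 1) (hx0 : ∀ i, 0 ≤ x i) (hx1 : ∀ i, x i ≤ 1) (hxy : ∀ i, x i ≤ y i)
    (hy : ∀ i, a * (1 - x i) ≤ 1 - y i) :
    P.F x + a ^ n * ∑ i, (y i - x i) * P.gradF x i ≤ P.F y := by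
  -- Raise one coordinate at a time: `F` is affine in it, and each intermediate point obeys the same
  -- bounds relative to `x` as `y` does.
  have key : ∀ s : Finset (Fin n),
      P.F x + a ^ n * ∑ i ∈ s, (y i - x i) * P.gradF x i ≤ P.F (s.piecewise y x) := by
    intro s
    induction s using Finset.induction_on with
    | empty => simp
    | insert i s hi ih =>
      have h := P.pow_mul_gradF_le hf (y := s.piecewise y x) ha0 ha1 hx0 hx1
        (fun j => by by_cases hj : j ∈ s <;> simp [hj, hxy])
        (fun j => by
          by_cases hj : j ∈ s
          · simpa [hj] using hy j
          · simpa [hj] using mul_le_of_le_one_left (sub_nonneg.2 (hx1 j)) ha1) i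
      rw [Finset.sum_insert hi, Finset.piecewise_insert, F_update,
        Finset.piecewise_eq_of_notMem _ _ _ hi]
      have h' := mul_le_mul_of_nonneg_left h (sub_nonneg.2 (hxy i))
      linarith
  simpa using key Finset.univ

variable {P} in
/-- Continuous greedy keeps its invariants and closes the gap to every feasible policy at an
exponential rate. -/
theorem IsGreedyOutput.exp_bound {t₀ : ℕ} {l δ : ℝ} {y : Fin n → ℕ → ℝ}
    (hy : P.IsGreedyOutput t₀ l δ y) (hδ : 0 < δ) (hl : 0 ≤ l) (hl4 : l ≤ 1 / 4) :
    P.IsScaledFractional t₀ l y ∧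
      (δ ≤ 1 / 2 → Monotone P.f → LatticeSubmodular P.f → t₀ ≤ 1 →
        (∀ i, (∀ s, P.c i s ≤ P.C) → ∀ s, t₀ + P.c i s ≤ P.C) →
        ∀ π : Policy n B, P.Feasible π →
          P.favg π - P.F (P.bar t₀ y) ≤ Real.exp (-((1 - 2 * δ) ^ n * l)) * P.favg π) := by
  obtain ⟨Y, hY0, rfl, hstep⟩ := hy
  have main : ∀ k ≤ ⌈l / δ⌉₊, P.IsScaledFractional t₀ (min (k * δ) l) (Y k) ∧
      (δ ≤ 1 / 2 → Monotone P.f → LatticeSubmodular P.f → t₀ ≤ 1 →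
        (∀ i, (∀ s, P.c i s ≤ P.C) → ∀ s, t₀ + P.c i s ≤ P.C) →
        ∀ π : Policy n B, P.Feasible π →
          P.favg π - P.F (P.bar t₀ (Y k)) ≤
            Real.exp (-((1 - 2 * δ) ^ n * min (k * δ) l)) * P.favg π) := by
    intro k
    induction k with
    | zero =>
      intro _
      rw [hY0, Nat.cast_zero, zero_mul, min_eq_left hl]
      refine ⟨P.isScaledFractional_zero t₀, fun _ _ _ _ _ π _ => ?_⟩
      have := P.F_nonneg (x := P.bar t₀ 0) (by simp [bar_zero]) (by simp [bar_zero])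
      simpa using this
    | succ k ih =>
      intro hk
      obtain ⟨hsc, hbd⟩ := ih (by omega)
      obtain ⟨v, hv, hmax, hYk⟩ := hstep k (by omega)
      have hkl : k * δ < l := (lt_div_iff₀ hδ).1 (Nat.lt_ceil.1 (by omega))
      set h := min δ (l - k * δ) with hh
      have hh0 : 0 ≤ h := le_min hδ.le (by linarith)
      have hhδ : h ≤ δ := min_le_left _ _
      have hθ : min ((k : ℝ) * δ) l = k * δ := min_eq_left hkl.le
      have hθ' : min (((k + 1 : ℕ) : ℝ) * δ) l = k * δ + h := by
        rw [hh, ← min_add_add_left]; push_cast; congr 1 <;> ring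
      rw [hθ] at hsc hbd
      have hθ0 : 0 ≤ (k : ℝ) * δ := by positivity
      rw [hθ', hYk]
      refine ⟨hsc.add_smul hθ0 hh0 hv, fun hδ2 hf hs ht₀ hC π hπ => ?_⟩
      have hb0 := hsc.bar_nonneg
      have hb4 : ∀ i, P.bar t₀ (Y k) i ≤ 1 / 4 := fun i => (hsc.bar_le i).trans (by linarith)
      have hb1 : ∀ i, P.bar t₀ (Y k) i ≤ 1 := fun i => (hb4 i).trans (by norm_num)
      have hv0 : ∀ i, 0 ≤ P.bar t₀ v i := fun i => Finset.sum_nonneg fun t _ => hv.nonneg i t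
      set x := P.bar t₀ (Y k) with hx
      set κ := (1 - 2 * δ) ^ n with hκ
      have hκ0 : 0 ≤ κ := pow_nonneg (by linarith) n
      have hκ1 : κ ≤ 1 := pow_le_one₀ (by linarith) (by linarith)
      -- The factor `1 - 2 * δ` works because coordinates are at most 1/4: a step lowers `1 - x i`
      -- by at most `δ`, which is less than `2 * δ * (1 - x i)`.
      have hF := P.F_add_pow_mul_le hf (x := x) (y := x + h • P.bar t₀ v) (a := 1 - 2 * δ)
        (by linarith) (by linarith) hb0 hb1
        (fun i => le_add_of_nonneg_right (mul_nonneg hh0 (hv0 i)))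
        (fun i => by
          have h1 : h * P.bar t₀ v i ≤ δ :=
            (mul_le_of_le_one_right hh0 (hv.bar_le_one i)).trans hhδ
          have h2 := mul_le_mul_of_nonneg_left (hb4 i) hδ.le
          simp only [Pi.add_apply, Pi.smul_apply, smul_eq_mul]
          nlinarith)
      have hg := P.favg_sub_F_le hf hs π hb0 hb1
      have hw := hmax _ (P.isFractional_slotProb ht₀ hC hπ)
      simp only [P.bar_slotProb hC hπ] at hw
      have hsum : ∑ i, ((x + h • P.bar t₀ v) i - x i) * P.gradF x i =
          h * ∑ i, P.gradF x i * P.bar t₀ v i := by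
        rw [Finset.mul_sum]
        exact Finset.sum_congr rfl fun i _ => by simp; ring
      rw [hsum, ← hκ] at hF
      rw [bar_add_smul, mul_add, neg_add, Real.exp_add]
      have hO := P.favg_nonneg π
      have hκh : κ * h ≤ 1 := mul_le_one₀ hκ1 hh0 (by linarith)
      -- The start times of `π` compete with `v`, so the step gains at least `κ * h` times the gap;
      -- the remaining gap shrinks by `1 - κ * h`.
      have h1 : κ * h * (P.favg π - P.F x) ≤ κ * (h * ∑ i, P.gradF x i * P.bar t₀ v i) := by
        rw [mul_assoc]
        exact mul_le_mul_of_nonneg_left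
          (mul_le_mul_of_nonneg_left (hg.trans hw) hh0) hκ0
      have h2 := mul_le_mul_of_nonneg_left (hbd hδ2 hf hs ht₀ hC π hπ) (sub_nonneg.2 hκh)
      have h3 : 1 - κ * h ≤ Real.exp (-(κ * h)) := by linarith [Real.add_one_le_exp (-(κ * h))]
      have h4 := mul_le_mul_of_nonneg_right h3
        (mul_nonneg (Real.exp_pos (-(κ * (k * δ)))).le hO)
      linarith
  have hend : min ((⌈l / δ⌉₊ : ℝ) * δ) l = l :=
    min_eq_right ((div_le_iff₀ hδ).1 (Nat.le_ceil _))
  have := main _ le_rfl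
  rwa [hend] at this

variable {P} in
-- By Bernoulli's inequality `(1 - 2 * δ) ^ n` is at least `1 - 2 * n * δ`, so replacing it by 1 in
-- the exponent costs at most `2 * n * δ`.
theorem IsGreedyOutput.favg_le {t₀ : ℕ} {l δ : ℝ} {y : Fin n → ℕ → ℝ}
    (hy : P.IsGreedyOutput t₀ l δ y) (hδ : 0 < δ) (hδ2 : δ ≤ 1 / 2) (hl : 0 ≤ l)
    (hl4 : l ≤ 1 / 4) (hf : Monotone P.f) (hs : LatticeSubmodular P.f) (ht₀ : t₀ ≤ 1)
    (hC : ∀ i, (∀ s, P.c i s ≤ P.C) → ∀ s, t₀ + P.c i s ≤ P.C) {π : Policy n B}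
    (hπ : P.Feasible π) :
    (1 - Real.exp (-l) - 2 * n * δ) * P.favg π ≤ P.F (P.bar t₀ y) := by
  have h := (hy.exp_bound hδ hl hl4).2 hδ2 hf hs ht₀ hC π hπ
  set κ := (1 - 2 * δ) ^ n with hκ
  have hκ1 : κ ≤ 1 := pow_le_one₀ (by linarith) (by linarith)
  have hκ0 : 0 ≤ κ := pow_nonneg (by linarith) n
  have hκn : 1 - 2 * n * δ ≤ κ := by
    have := one_add_mul_le_pow (a := -(2 * δ)) (by linarith) n
    rw [← sub_eq_add_neg] at this
    linarith
  have hexp : Real.exp (-(κ * l)) ≤ Real.exp (-l) + 2 * n * δ := by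
    have e : Real.exp (-l) = Real.exp (-(κ * l)) * Real.exp (-((1 - κ) * l)) := by
      rw [← Real.exp_add]; congr 1; ring
    have h1 : 1 - (1 - κ) * l ≤ Real.exp (-((1 - κ) * l)) := by
      linarith [Real.add_one_le_exp (-((1 - κ) * l))]
    have h2 : Real.exp (-(κ * l)) ≤ 1 := Real.exp_le_one_iff.2 (by nlinarith)
    have h3 := mul_le_mul_of_nonneg_left h1 (Real.exp_pos (-(κ * l))).le
    have h4 : (1 - κ) * l ≤ 2 * n * δ :=
      (mul_le_of_le_one_right (by linarith) (by linarith)).trans (by linarith)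
    have h5 : Real.exp (-(κ * l)) * ((1 - κ) * l) ≤ (1 - κ) * l :=
      mul_le_of_le_one_left (mul_nonneg (by linarith) hl) h2
    rw [e]; linarith
  nlinarith [mul_le_mul_of_nonneg_right hexp (P.favg_nonneg π)]

end Problem

/-! ### The policy π^io: selection, starting times and feasibility. -/

namespace Problem

variable {n B : ℕ} (P : Problem n B)

theorem selected_visit_subset (τ : Fin n → ℕ) (σ : List (Fin n)) (C' : ℕ) (φ : Fin n → Fin B) :
    (P.visit τ σ C').selected φ ⊆ σ.toFinset := by
  induction σ generalizing C' with
  | nil => simp [visit, Policy.selected]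
  | cons i σ ih =>
    unfold visit
    rw [List.toFinset_cons]
    split_ifs
    · exact Finset.insert_subset_insert _ (ih _)
    · exact (ih _).trans (Finset.subset_insert _ _)

/-- An item is selected only at running cost at most `τ i`, and its slot leaves room for every
state, so the budget is an invariant of the loop. -/
theorem cost_visit_le (τ : Fin n → ℕ) (σ : List (Fin n)) {C' : ℕ} (φ : Fin n → Fin B)
    (hC' : C' ≤ P.C) (hτ : ∀ i ∈ σ, ∀ s, τ i + P.c i s ≤ P.C) :
    C' + ∑ i ∈ (P.visit τ σ C').selected φ, P.c i (φ i) ≤ P.C := by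
  induction σ generalizing C' with
  | nil => simpa [visit, Policy.selected] using hC'
  | cons i σ ih =>
    unfold visit
    have hτ' : ∀ i ∈ σ, ∀ s, τ i + P.c i s ≤ P.C := fun j hj => hτ j (List.mem_cons_of_mem _ hj)
    split_ifs with h
    · have hi := hτ i List.mem_cons_self (φ i)
      have := ih (C' := C' + P.c i (φ i)) (by omega) hτ'
      refine le_trans ?_ this
      rw [Policy.selected, add_assoc]
      refine Nat.add_le_add_left ?_ _
      by_cases hm : i ∈ (P.visit τ σ (C' + P.c i (φ i))).selected φ
      · rw [Finset.insert_eq_of_mem hm]; exact Nat.le_add_left _ _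
      · rw [Finset.sum_insert hm]
    · exact ih hC' hτ'

/-- The cost of the whole prefix, skipped items included, dominates the running cost when `i` is
visited. -/
theorem mem_selected_visit (τ : Fin n → ℕ) (σ σ' : List (Fin n)) (i : Fin n) (C' : ℕ)
    (φ : Fin n → Fin B) (h : C' + (σ.map fun j => P.c j (φ j)).sum ≤ τ i) :
    i ∈ (P.visit τ (σ ++ i :: σ') C').selected φ := by
  induction σ generalizing C' with
  | nil =>
    simp only [List.map_nil, List.sum_nil, add_zero] at h
    simp [visit, h, Policy.selected]
  | cons j σ ih =>
    rw [List.map_cons, List.sum_cons] at h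
    rw [List.cons_append, visit]
    split_ifs
    · exact Finset.mem_insert_of_mem (ih _ (by omega))
    · exact ih _ (by omega)

theorem mem_schedule {S : Finset (Fin n)} {τ : Fin n → ℕ} {i : Fin n} :
    i ∈ schedule S τ ↔ i ∈ S := by
  simp [schedule]

theorem nodup_schedule (S : Finset (Fin n)) (τ : Fin n → ℕ) : (schedule S τ).Nodup := by
  refine List.Nodup.map_on ?_ (Finset.sort_nodup _ _)
  intro a ha b hb hab
  simp only [Finset.mem_sort, Finset.mem_image] at ha hb
  obtain ⟨i, -, rfl⟩ := ha
  obtain ⟨j, -, rfl⟩ := hb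
  have : i = j := hab
  rw [this]

theorem pairwise_schedule (S : Finset (Fin n)) (τ : Fin n → ℕ) :
    (schedule S τ).Pairwise fun i j => τ i ≤ τ j := by
  rw [schedule, List.pairwise_map]
  have h := Finset.pairwise_sort (S.image fun i => toLex (τ i, i)) (· ≤ ·)
  refine h.imp_of_mem fun {a b} ha hb hab => ?_
  simp only [Finset.mem_sort, Finset.mem_image] at ha hb
  obtain ⟨i, -, rfl⟩ := ha
  obtain ⟨j, -, rfl⟩ := hb
  rcases Prod.Lex.toLex_le_toLex.1 hab with h | h
  · exact h.le
  · exact h.1.le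

/-- A visited item is selected if all other items with earlier starting times fit before its own. -/
theorem mem_selected_of_cost_le {S : Finset (Fin n)} {τ : Fin n → ℕ} {i : Fin n} (hi : i ∈ S)
    (φ : Fin n → Fin B) (h : ∑ j ∈ S.erase i with τ j ≤ τ i, P.c j (φ j) ≤ τ i) :
    i ∈ (P.visit τ (schedule S τ) 0).selected φ := by
  obtain ⟨σ, σ', e⟩ := List.append_of_mem ((mem_schedule (τ := τ)).2 hi)
  have hnd := nodup_schedule S τ
  have hpw := pairwise_schedule S τ
  have hmem : ∀ j ∈ σ, j ∈ S := fun j hj => (mem_schedule (τ := τ)).1 (by rw [e]; simp [hj])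
  rw [e] at hnd hpw ⊢
  rw [List.nodup_append] at hnd
  rw [List.pairwise_append] at hpw
  refine P.mem_selected_visit τ σ σ' i 0 φ (le_trans ?_ h)
  rw [zero_add, ← List.sum_toFinset _ hnd.1]
  refine Finset.sum_le_sum_of_subset fun j hj => ?_
  rw [List.mem_toFinset] at hj
  simp only [Finset.mem_filter, Finset.mem_erase]
  exact ⟨⟨hnd.2.2 j hj i List.mem_cons_self, hmem j hj⟩, hpw.2.2 j hj i List.mem_cons_self⟩

/-- The probability that an item included in the random set has starting time `t`. -/
noncomputable def startProb (t₀ : ℕ) (y : Fin n → ℕ → ℝ) (i : Fin n) (t : ℕ) : ℝ :=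
  y i t / P.bar t₀ y i

/-- The tuples of starting times of the items of `S`. -/
noncomputable def startTimes (t₀ : ℕ) (S : Finset (Fin n)) : Finset (Fin n → ℕ) :=
  Fintype.piFinset fun i => if i ∈ S then P.slots t₀ i else {0}

/-- The probability of a tuple of starting times of the items of `S`. -/
noncomputable def timesProb (t₀ : ℕ) (y : Fin n → ℕ → ℝ) (S : Finset (Fin n)) (τ : Fin n → ℕ) : ℝ :=
  ∏ i ∈ S, P.startProb t₀ y i (τ i)

theorem sum_startTimes_prod (t₀ : ℕ) (S : Finset (Fin n)) (g : Fin n → ℕ → ℝ) :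
    ∑ τ ∈ P.startTimes t₀ S, ∏ i ∈ S, g i (τ i) = ∏ i ∈ S, ∑ t ∈ P.slots t₀ i, g i t := by
  have h := Finset.prod_univ_sum (fun i => if i ∈ S then P.slots t₀ i else {0})
    (fun i t => if i ∈ S then g i t else 1)
  have e1 : ∏ i, ∑ t ∈ (if i ∈ S then P.slots t₀ i else {0}), (if i ∈ S then g i t else 1) =
      ∏ i ∈ S, ∑ t ∈ P.slots t₀ i, g i t := by
    rw [← Finset.prod_subset (Finset.subset_univ S) fun i _ hi => by simp [hi]]
    exact Finset.prod_congr rfl fun i hi => by simp [hi]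
  rw [← e1, h]
  exact Finset.sum_congr rfl fun τ _ => by simp

section Times

variable {P} {t₀ : ℕ} {y : Fin n → ℕ → ℝ} {S : Finset (Fin n)}

theorem sum_timesProb (hq : ∀ i ∈ S, ∑ t ∈ P.slots t₀ i, P.startProb t₀ y i t = 1) :
    ∑ τ ∈ P.startTimes t₀ S, P.timesProb t₀ y S τ = 1 := by
  unfold timesProb
  rw [sum_startTimes_prod]
  exact Finset.prod_eq_one hq

/-- The joint law of two starting times is a product, since the laws of all other items sum to one.
-/
theorem sum_timesProb_mul_mul (hq : ∀ i ∈ S, ∑ t ∈ P.slots t₀ i, P.startProb t₀ y i t = 1)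
    {i j : Fin n} (hi : i ∈ S) (hj : j ∈ S) (hij : j ≠ i) (h : ℕ → ℕ → ℝ) :
    ∑ τ ∈ P.startTimes t₀ S, P.timesProb t₀ y S τ * h (τ i) (τ j) =
      ∑ t ∈ P.slots t₀ i, P.startProb t₀ y i t *
        ∑ t' ∈ P.slots t₀ j, P.startProb t₀ y j t' * h t t' := by
  have e : ∀ t ∈ P.slots t₀ i,
      ∑ τ ∈ P.startTimes t₀ S,
        P.timesProb t₀ y S τ * ((if τ i = t then 1 else 0) * h t (τ j)) =
      P.startProb t₀ y i t * ∑ t' ∈ P.slots t₀ j, P.startProb t₀ y j t' * h t t' := by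
    intro t ht
    have e := P.sum_startTimes_prod t₀ S fun k u => P.startProb t₀ y k u *
      ((if k = i then (if u = t then 1 else 0) else 1) * if k = j then h t u else 1)
    -- With `τ i` pinned to `t` by an indicator, the weight is a product over items and the sum
    -- factors.
    rw [← Finset.mul_prod_erase _ _ hi,
      Finset.prod_eq_single_of_mem j (Finset.mem_erase.2 ⟨hij, hj⟩) fun k hk hkj => by
        simpa [hkj, Finset.ne_of_mem_erase hk] using hq k (Finset.mem_of_mem_erase hk)] at e
    simp only [if_true, hij, if_false, one_mul, hij.symm, mul_one, mul_ite, mul_zero,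
      Finset.sum_ite_eq', ht] at e
    rw [← e]
    refine Finset.sum_congr rfl fun τ _ => ?_
    have e1 := Finset.prod_ite_eq' S i fun k => if τ k = t then (1 : ℝ) else 0
    have e2 := Finset.prod_ite_eq' S j fun k => h t (τ k)
    rw [if_pos hi] at e1
    rw [if_pos hj] at e2
    rw [← e1, ← e2, timesProb, ← Finset.prod_mul_distrib, ← Finset.prod_mul_distrib]
    exact Finset.prod_congr rfl fun k _ => by split_ifs <;> simp
  rw [← Finset.sum_congr rfl e, Finset.sum_comm]
  refine Finset.sum_congr rfl fun τ hτ => ?_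
  have hτi : τ i ∈ P.slots t₀ i := by
    simpa [hi] using Fintype.mem_piFinset.1 hτ i
  rw [← Finset.mul_sum, Finset.sum_eq_single_of_mem (τ i) hτi fun t _ hne => by
    rw [if_neg hne.symm, zero_mul], if_pos rfl, one_mul]

end Times

/-- The expected value of a function of the deterministic policy that `π^io` runs. -/
theorem sum_ioPolicy (t₀ : ℕ) (y : Fin n → ℕ → ℝ) (χ : (Fin n → ℝ) → RandomSetMap n)
    (g : Policy n B → ℝ) :
    ((P.ioPolicy t₀ y χ).sum fun π w => w * g π) =
      ∑ R, inclusionProb (P.bar t₀ y) R * ∑ S, χ (P.bar t₀ y) R S *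
        ∑ τ ∈ P.startTimes t₀ S, P.timesProb t₀ y S τ * g (P.visit τ (schedule S τ) 0) := by
  have e : ((P.ioPolicy t₀ y χ).sum fun π w => w * g π) =
      Finsupp.linearCombination ℝ g (P.ioPolicy t₀ y χ) := by
    rw [Finsupp.linearCombination_apply]; rfl
  rw [e, ioPolicy]
  simp only [map_sum, Finsupp.linearCombination_single, smul_eq_mul, Finset.mul_sum]
  exact Finset.sum_congr rfl fun R _ => Finset.sum_congr rfl fun S _ =>
    Finset.sum_congr rfl fun τ _ => by simp only [timesProb, startProb]; ring

section IoPolicy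

variable {P} {t₀ : ℕ} {l γ : ℝ} {y : Fin n → ℕ → ℝ} {χ : (Fin n → ℝ) → RandomSetMap n}

theorem IsScaledFractional.startProb_nonneg (hy : P.IsScaledFractional t₀ l y) (i : Fin n)
    (t : ℕ) : 0 ≤ P.startProb t₀ y i t :=
  div_nonneg (hy.nonneg i t) (hy.bar_nonneg i)

theorem sum_startProb {i : Fin n} (hi : P.bar t₀ y i ≠ 0) :
    ∑ t ∈ P.slots t₀ i, P.startProb t₀ y i t = 1 := by
  simp only [startProb, ← Finset.sum_div]
  exact div_self hi

theorem bar_ne_zero_of_inclusionProb_ne_zero {x : Fin n → ℝ} {R : Finset (Fin n)}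
    (hR : inclusionProb x R ≠ 0) {i : Fin n} (hi : i ∈ R) : x i ≠ 0 :=
  Finset.prod_ne_zero_iff.1 (left_ne_zero_of_mul hR) i hi

theorem IsScaledFractional.isProbability_ioPolicy (hy : P.IsScaledFractional t₀ l y) (hl : l ≤ 1)
    (hχ : IsMonotoneBalancedCRSAt P.Iout γ (P.bar t₀ y) (χ (P.bar t₀ y))) :
    (P.ioPolicy t₀ y χ).IsProbability := by
  classical
  have hb1 : ∀ i, P.bar t₀ y i ≤ 1 := fun i => (hy.bar_le i).trans hl
  constructor
  · intro π
    rw [ioPolicy]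
    simp only [Finsupp.finsetSum_apply, Finsupp.single_apply]
    refine Finset.sum_nonneg fun R _ => Finset.sum_nonneg fun S _ => Finset.sum_nonneg fun τ _ => ?_
    split_ifs
    · exact mul_nonneg (mul_nonneg (inclusionProb_nonneg hy.bar_nonneg hb1 R) (hχ.nonneg R S))
        (Finset.prod_nonneg fun i _ => hy.startProb_nonneg i _)
    · exact le_rfl
  · have h := P.sum_ioPolicy t₀ y χ fun _ => 1
    simp only [mul_one] at h
    rw [h, ← sum_inclusionProb (P.bar t₀ y)]
    refine Finset.sum_congr rfl fun R _ => ?_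
    -- If `ȳ(i) = 0`, the starting law of `i` is 0/0 = 0 and not a distribution; sets containing
    -- such an `i` have weight zero.
    by_cases hR : inclusionProb (P.bar t₀ y) R = 0
    · rw [hR, zero_mul]
    · rw [← mul_one (inclusionProb (P.bar t₀ y) R), mul_assoc, one_mul, ← hχ.sum_eq_one R]
      congr 1
      refine Finset.sum_congr rfl fun S _ => ?_
      by_cases hS : χ (P.bar t₀ y) R S = 0
      · rw [hS, zero_mul]
      · rw [sum_timesProb fun i hi => sum_startProb
          (bar_ne_zero_of_inclusionProb_ne_zero hR (hχ.subset R S hS hi)), mul_one]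

theorem feasibleRandom_ioPolicy
    (hχ : IsMonotoneBalancedCRSAt P.Iout γ (P.bar t₀ y) (χ (P.bar t₀ y))) :
    P.FeasibleRandom (P.ioPolicy t₀ y χ) := by
  classical
  intro π hπ
  rw [Finsupp.mem_support_iff, ioPolicy] at hπ
  simp only [Finsupp.finsetSum_apply, Finsupp.single_apply] at hπ
  obtain ⟨R, -, hπ⟩ := Finset.exists_ne_zero_of_sum_ne_zero hπ
  obtain ⟨S, -, hπ⟩ := Finset.exists_ne_zero_of_sum_ne_zero hπ
  obtain ⟨τ, hτ, hπ⟩ := Finset.exists_ne_zero_of_sum_ne_zero hπ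
  rw [ite_ne_right_iff] at hπ
  obtain ⟨rfl, hw⟩ := hπ
  have hS := right_ne_zero_of_mul (left_ne_zero_of_mul hw)
  constructor
  · intro φ
    have := P.cost_visit_le τ (schedule S τ) (C' := 0) φ (Nat.zero_le _) fun i hi => by
      have h := Fintype.mem_piFinset.1 hτ i
      rw [if_pos (mem_schedule.1 hi)] at h
      exact (P.bounds_of_mem_slots h).2.2
    rwa [zero_add] at this
  · intro φ
    refine P.Iout_lower (fun i hi => ?_) (hχ.mem R S hS)
    exact mem_schedule.1 (List.mem_toFinset.1 (P.selected_visit_subset _ _ _ _ hi))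

end IoPolicy

end Problem

/-! ### The loss in rounding: marginals, Markov's bound and Harris' inequality. -/

namespace Problem

variable {n B : ℕ} (P : Problem n B)

/-- The gain of raising item `i` to state `s`, on top of the items of `R` of smaller index. -/
noncomputable def marginal (i : Fin n) (s : Fin B) (R : Finset (Fin n)) (φ : Fin n → Fin B) : ℝ :=
  P.f (restrictTo φ {j ∈ R | j < i} ⊔ Pi.single i s.succ) - P.f (restrictTo φ {j ∈ R | j < i})

theorem marginal_nonneg (hf : Monotone P.f) (i : Fin n) (s : Fin B) (R : Finset (Fin n))
    (φ : Fin n → Fin B) : 0 ≤ P.marginal i s R φ :=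
  sub_nonneg.2 (hf le_sup_left)

theorem marginal_anti (hs : LatticeSubmodular P.f) (i : Fin n) (s : Fin B)
    {R R' : Finset (Fin n)} {φ φ' : Fin n → Fin B} (hR : R ⊆ R') (hφ : φ ≤ φ') :
    P.marginal i s R' φ' ≤ P.marginal i s R φ :=
  hs _ _ (restrictTo_mono hφ (Finset.filter_subset_filter _ hR)) _ _

theorem marginal_insert (i : Fin n) (s : Fin B) (R : Finset (Fin n)) (φ : Fin n → Fin B) :
    P.marginal i s (insert i R) φ = P.marginal i s R φ := by
  simp [marginal, Finset.filter_insert]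

theorem marginal_update (i : Fin n) (s s' : Fin B) (R : Finset (Fin n)) (φ : Fin n → Fin B) :
    P.marginal i s R (Function.update φ i s') = P.marginal i s R φ := by
  simp [marginal, restrictTo_update_of_notMem]

/-- Telescoping in index order rather than selection order: a marginal sees only smaller indices, so
adding a largest item leaves the others unchanged. -/
theorem f_restrictTo_eq_sum_marginal (φ : Fin n → Fin B) (R : Finset (Fin n)) :
    P.f (restrictTo φ R) = P.f 0 + ∑ i ∈ R, P.marginal i (φ i) R φ := by
  induction R using Finset.induction_on_max with
  | empty => simp
  | insert a R hR ih =>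
    have ha : a ∉ R := fun h => lt_irrefl a (hR a h)
    rw [Finset.sum_insert ha, marginal_insert, restrictTo_insert]
    have e : ∑ i ∈ R, P.marginal i (φ i) (insert a R) φ = ∑ i ∈ R, P.marginal i (φ i) R φ :=
      Finset.sum_congr rfl fun i hi => by
        simp [marginal, Finset.filter_insert, (hR i hi).not_gt]
    have e' : R.filter (· < a) = R := Finset.filter_true_of_mem hR
    rw [e, marginal, e', ← sub_add_cancel (P.f (restrictTo φ R ⊔ _)) (P.f (restrictTo φ R)), ih]
    ring

/-- The probability that item `j` is to start by time `t`. -/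
noncomputable def startedProb (t₀ : ℕ) (y : Fin n → ℕ → ℝ) (j : Fin n) (t : ℕ) : ℝ :=
  ∑ t' ∈ P.slots t₀ j, P.startProb t₀ y j t' * if t' ≤ t then 1 else 0

/-- Markov's bound for the probability that item `i`, with starting time `t`, is not blocked by the
other items of `R`. -/
noncomputable def slack (t₀ : ℕ) (y : Fin n → ℕ → ℝ) (i : Fin n) (t : ℕ) (R : Finset (Fin n))
    (φ : Fin n → Fin B) : ℝ :=
  1 - (∑ j ∈ R.erase i, P.startedProb t₀ y j t * (min (P.c j (φ j)) (max t 1) : ℕ)) /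
    (max t 1 : ℕ)

/-- The average of `slack` over the starting time of item `i`. -/
noncomputable def avgSlack (t₀ : ℕ) (y : Fin n → ℕ → ℝ) (i : Fin n) (R : Finset (Fin n))
    (φ : Fin n → Fin B) : ℝ :=
  ∑ t ∈ P.slots t₀ i, P.startProb t₀ y i t * P.slack t₀ y i t R φ

theorem avgSlack_insert (t₀ : ℕ) (y : Fin n → ℕ → ℝ) (i : Fin n) (R : Finset (Fin n))
    (φ : Fin n → Fin B) : P.avgSlack t₀ y i (insert i R) φ = P.avgSlack t₀ y i R φ := by
  have e : (insert i R).erase i = R.erase i := by ext; simp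
  simp only [avgSlack, slack, e]

theorem avgSlack_update (t₀ : ℕ) (y : Fin n → ℕ → ℝ) (i : Fin n) (s : Fin B)
    (R : Finset (Fin n)) (φ : Fin n → Fin B) :
    P.avgSlack t₀ y i R (Function.update φ i s) = P.avgSlack t₀ y i R φ := by
  simp only [avgSlack, slack]
  refine Finset.sum_congr rfl fun t _ => ?_
  rw [Finset.sum_congr rfl fun j hj => by rw [Function.update_of_ne (Finset.ne_of_mem_erase hj)]]

section

variable {P} {t₀ : ℕ} {l γ : ℝ} {y : Fin n → ℕ → ℝ} {χ : (Fin n → ℝ) → RandomSetMap n}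

theorem IsScaledFractional.startedProb_nonneg (hy : P.IsScaledFractional t₀ l y) (j : Fin n)
    (t : ℕ) : 0 ≤ P.startedProb t₀ y j t :=
  Finset.sum_nonneg fun t' _ => mul_nonneg (hy.startProb_nonneg j t') (by positivity)

/-- More items and higher, hence costlier, states can only block more. -/
theorem IsScaledFractional.avgSlack_anti (hy : P.IsScaledFractional t₀ l y)
    (hc : ∀ i, Monotone (P.c i)) (i : Fin n) {R R' : Finset (Fin n)} {φ φ' : Fin n → Fin B}
    (hR : R ⊆ R') (hφ : φ ≤ φ') : P.avgSlack t₀ y i R' φ' ≤ P.avgSlack t₀ y i R φ := by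
  refine Finset.sum_le_sum fun t _ => mul_le_mul_of_nonneg_left ?_ (hy.startProb_nonneg i t)
  refine sub_le_sub_left (div_le_div_of_nonneg_right ?_ (Nat.cast_nonneg _)) 1
  refine (Finset.sum_le_sum fun j _ => ?_).trans (Finset.sum_le_sum_of_subset_of_nonneg
    (Finset.erase_subset_erase i hR) fun j _ _ =>
      mul_nonneg (hy.startedProb_nonneg j t) (Nat.cast_nonneg _))
  exact mul_le_mul_of_nonneg_left (Nat.cast_le.2 (min_le_min_right _ (hc j (hφ j))))
    (hy.startedProb_nonneg j t)

/-- For fixed starting times, the indicator that an item of the schedule is selected is at least a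
linear function of the truncated costs of the other items. -/
theorem one_sub_le_indicator_selected {S : Finset (Fin n)} {τ : Fin n → ℕ} {i : Fin n}
    (hi : i ∈ S) (φ : Fin n → Fin B) :
    1 - (∑ j ∈ S.erase i, (if τ j ≤ τ i then 1 else 0) *
        ((min (P.c j (φ j)) (max (τ i) 1) : ℕ) : ℝ)) / (max (τ i) 1 : ℕ) ≤
      if i ∈ (P.visit τ (schedule S τ) 0).selected φ then 1 else 0 := by
  -- Slot 0 occurs if `t₀ = 0`. As costs are integers, blocking means cost at least `τ i + 1`, hence
  -- at least `T`, and division by zero is avoided.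
  set T := max (τ i) 1 with hT
  have hT0 : (0 : ℝ) < T := by exact_mod_cast lt_of_lt_of_le one_pos (le_max_right _ _)
  have hnn : ∀ j ∈ S.erase i, (0 : ℝ) ≤
      (if τ j ≤ τ i then 1 else 0) * ((min (P.c j (φ j)) T : ℕ) : ℝ) := fun j _ => by positivity
  split_ifs with hsel
  · exact sub_le_self _ (div_nonneg (Finset.sum_nonneg hnn) hT0.le)
  · have hcost := mt (P.mem_selected_of_cost_le hi φ) hsel
    rw [sub_nonpos, one_le_div hT0]
    have e : (∑ j ∈ S.erase i, (if τ j ≤ τ i then 1 else 0) *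
        ((min (P.c j (φ j)) T : ℕ) : ℝ)) =
        ((∑ j ∈ S.erase i with τ j ≤ τ i, min (P.c j (φ j)) T : ℕ) : ℝ) := by
      rw [Finset.sum_filter]
      push_cast
      exact Finset.sum_congr rfl fun j _ => by split_ifs <;> simp
    rw [e]
    refine Nat.cast_le.2 ?_
    -- Truncation loses nothing: either one cost reaches `T` and suffices alone, or no cost is
    -- truncated.
    by_cases hbig : ∃ j ∈ {j ∈ S.erase i | τ j ≤ τ i}, T ≤ P.c j (φ j)
    · obtain ⟨j, hj, hjT⟩ := hbig
      refine le_trans ?_ (Finset.single_le_sum (f := fun j => min (P.c j (φ j)) T)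
        (fun _ _ => Nat.zero_le _) hj)
      exact le_min hjT le_rfl
    · push Not at hbig
      rw [Finset.sum_congr rfl fun j hj => min_eq_left (hbig j hj).le]
      omega

/-- The expected utility of the adaptive loop over the starting times of the items of `S`. -/
theorem IsScaledFractional.sum_timesProb_f_ge (hy : P.IsScaledFractional t₀ l y)
    (hf : Monotone P.f) (hs : LatticeSubmodular P.f) (hc : ∀ i, Monotone (P.c i))
    {S R : Finset (Fin n)} (hSR : S ⊆ R)
    (hq : ∀ i ∈ S, ∑ t ∈ P.slots t₀ i, P.startProb t₀ y i t = 1) (φ : Fin n → Fin B) :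
    P.f 0 + ∑ i ∈ S, P.marginal i (φ i) R φ * P.avgSlack t₀ y i R φ ≤
      ∑ τ ∈ P.startTimes t₀ S, P.timesProb t₀ y S τ *
        P.f (restrictTo φ ((P.visit τ (schedule S τ) 0).selected φ)) := by
  have hpt : ∀ τ : Fin n → ℕ, P.f 0 + ∑ i ∈ S, P.marginal i (φ i) R φ *
      (1 - (∑ j ∈ S.erase i, (if τ j ≤ τ i then 1 else 0) *
        ((min (P.c j (φ j)) (max (τ i) 1) : ℕ) : ℝ)) / (max (τ i) 1 : ℕ)) ≤
      P.f (restrictTo φ ((P.visit τ (schedule S τ) 0).selected φ)) := by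
    intro τ
    set A := (P.visit τ (schedule S τ) 0).selected φ with hA
    have hAS : A ⊆ S := fun i hi =>
      mem_schedule.1 (List.mem_toFinset.1 (P.selected_visit_subset _ _ _ _ hi))
    rw [f_restrictTo_eq_sum_marginal]
    refine add_le_add_right ?_ _
    calc _ ≤ ∑ i ∈ S, P.marginal i (φ i) R φ * (if i ∈ A then 1 else 0) :=
          Finset.sum_le_sum fun i hi => mul_le_mul_of_nonneg_left
            (one_sub_le_indicator_selected hi φ) (P.marginal_nonneg hf _ _ _ _)
      _ = ∑ i ∈ A, P.marginal i (φ i) R φ := by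
          simp only [mul_ite, mul_one, mul_zero]
          rw [Finset.sum_ite_mem, Finset.inter_eq_right.2 hAS]
      _ ≤ _ := Finset.sum_le_sum fun i _ => P.marginal_anti hs _ _ (hAS.trans hSR) le_rfl
  have hw : ∀ τ, 0 ≤ P.timesProb t₀ y S τ := fun τ =>
    Finset.prod_nonneg fun i _ => hy.startProb_nonneg i _
  refine le_trans ?_ (Finset.sum_le_sum fun τ _ => mul_le_mul_of_nonneg_left (hpt τ) (hw τ))
  simp only [mul_add, Finset.sum_add_distrib, ← Finset.sum_mul, sum_timesProb hq, one_mul]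
  refine add_le_add_right ?_ _
  simp only [Finset.mul_sum]
  rw [Finset.sum_comm]
  refine Finset.sum_le_sum fun i hi => ?_
  simp only [mul_left_comm _ (P.marginal _ _ _ _), ← Finset.mul_sum]
  refine mul_le_mul_of_nonneg_left ?_ (P.marginal_nonneg hf _ _ _ _)
  -- Only items of `S` can block, but the bound is relaxed to `R`, whose items are independent.
  refine (hy.avgSlack_anti hc i hSR le_rfl).trans (le_of_eq ?_)
  simp only [mul_sub, mul_one, Finset.sum_sub_distrib, sum_timesProb hq, avgSlack, slack,
    hq i hi]
  congr 1
  simp only [Finset.sum_div, Finset.mul_sum]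
  rw [Finset.sum_comm, Finset.sum_comm (s := P.startTimes t₀ S)]
  refine Finset.sum_congr rfl fun j hj => ?_
  have h := sum_timesProb_mul_mul hq hi (Finset.mem_of_mem_erase hj) (Finset.ne_of_mem_erase hj)
    fun t t' => (if t' ≤ t then 1 else 0) *
      ((min (P.c j (φ j)) (max t 1) : ℕ) : ℝ) / (max t 1 : ℕ)
  rw [h]
  refine Finset.sum_congr rfl fun t _ => ?_
  simp only [startedProb, Finset.sum_mul, Finset.sum_div]
  congr 1
  exact Finset.sum_congr rfl fun t' _ => by ring

theorem IsScaledFractional.bar_mul_startedProb_le (hy : P.IsScaledFractional t₀ l y) (j : Fin n)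
    {t T : ℕ} (hT : t ≤ T) :
    P.bar t₀ y j * P.startedProb t₀ y j t ≤ ∑ t' ∈ Finset.Icc t₀ T, y j t' := by
  by_cases hb : P.bar t₀ y j = 0
  · rw [hb, zero_mul]
    exact Finset.sum_nonneg fun t _ => hy.nonneg j t
  · rw [startedProb, Finset.mul_sum]
    simp only [startProb, mul_div_cancel₀ _ hb, mul_ite, mul_one, mul_zero]
    rw [← Finset.sum_filter]
    refine Finset.sum_le_sum_of_subset_of_nonneg (fun t' ht' => ?_) fun t _ _ => hy.nonneg j t
    rw [Finset.mem_filter] at ht'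
    exact Finset.mem_Icc.2 ⟨(P.bounds_of_mem_slots ht'.1).1, ht'.2.trans hT⟩

theorem truncCost_nonneg (j : Fin n) (T : ℕ) : 0 ≤ P.truncCost j T :=
  Finset.sum_nonneg fun s _ => mul_nonneg (P.p_nonneg j s) (Nat.cast_nonneg _)

/-- The constraint is available only for times from 1 to `P.C`. If `P.C = 0`, every item with
positive weight has cost zero in all states. -/
theorem IsScaledFractional.knapsack_max (hy : P.IsScaledFractional t₀ l y) (hl : 0 ≤ l) {t : ℕ}
    (ht : t ≤ P.C) :
    ∑ j, P.truncCost j (max t 1) * ∑ t' ∈ Finset.Icc t₀ (max t 1), y j t' ≤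
      l * (2 * ((max t 1 : ℕ) : ℝ)) := by
  by_cases hC : 1 ≤ P.C
  · exact hy.knapsack _ (Finset.mem_Icc.2 ⟨le_max_right _ _, max_le ht hC⟩)
  · rw [Finset.sum_eq_zero fun j _ => ?_]
    · positivity
    · by_cases hz : ∀ t', y j t' = 0
      · simp [hz]
      · push Not at hz
        obtain ⟨t', ht'⟩ := hz
        have hslot : t' ∈ P.slots t₀ j := by_contra fun h => ht' (hy.eq_zero j t' h)
        have hc0 : ∀ s, P.c j s = 0 := fun s => by
          have := (P.bounds_of_mem_slots hslot).2.2 s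
          omega
        simp [truncCost, hc0]

theorem jointE_state (x : Fin n → ℝ) (j : Fin n) (h : Fin B → ℝ) :
    P.jointE x (fun _ φ => h (φ j)) = ∑ s, P.p j s * h s := by
  have e := P.sum_prob_mul_indep j (fun _ => 1) h fun _ _ => rfl
  simp only [one_mul, mul_one, P.sum_prob] at e
  rw [jointE_eq_set]
  simp only [e, ← Finset.sum_mul, sum_inclusionProb, one_mul]

/-- By linearity, item `j` contributes at most its term in the knapsack constraint at `T = max t 1`;
these terms sum to at most `2 * l * T`, and dividing by `T` gives `2 * l`. -/
theorem IsScaledFractional.le_jointE_avgSlack (hy : P.IsScaledFractional t₀ l y) (hl : 0 ≤ l)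
    {i : Fin n} (hi : P.bar t₀ y i ≠ 0) :
    1 - 2 * l ≤ P.jointE (P.bar t₀ y) (P.avgSlack t₀ y i) := by
  have e : P.jointE (P.bar t₀ y) (P.avgSlack t₀ y i) = ∑ t ∈ P.slots t₀ i,
      P.startProb t₀ y i t * P.jointE (P.bar t₀ y) (P.slack t₀ y i t) := by
    have := jointE_sum (P := P) (x := P.bar t₀ y) (P.slots t₀ i)
      fun t R φ => P.startProb t₀ y i t * P.slack t₀ y i t R φ
    simp only [jointE_const_mul] at this
    exact this
  have hone : 1 - 2 * l = ∑ t ∈ P.slots t₀ i, P.startProb t₀ y i t * (1 - 2 * l) := by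
    rw [← Finset.sum_mul, sum_startProb hi, one_mul]
  rw [e, hone]
  refine Finset.sum_le_sum fun t ht => mul_le_mul_of_nonneg_left ?_ (hy.startProb_nonneg i t)
  set T := max t 1 with hT
  have hT0 : (0 : ℝ) < T := by exact_mod_cast lt_of_lt_of_le one_pos (le_max_right _ _)
  have e2 : P.slack t₀ y i t = fun R φ => 1 - ∑ j ∈ Finset.univ.erase i,
      P.startedProb t₀ y j t / T * if j ∈ R then ((min (P.c j (φ j)) T : ℕ) : ℝ) else 0 := by
    funext R φ
    have hR : R.erase i = {j ∈ Finset.univ.erase i | j ∈ R} := by ext; simp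
    rw [slack, hR, Finset.sum_filter, Finset.sum_div]
    congr 1
    refine Finset.sum_congr rfl fun j _ => ?_
    split_ifs
    · ring
    · simp
  have e3 : ∀ j, P.jointE (P.bar t₀ y) (fun R φ =>
      if j ∈ R then ((min (P.c j (φ j)) T : ℕ) : ℝ) else 0) =
      P.bar t₀ y j * P.truncCost j T := fun j => by
    rw [jointE_mem j fun _ φ => ((min (P.c j (φ j)) T : ℕ) : ℝ),
      jointE_state _ j fun s => ((min (P.c j s) T : ℕ) : ℝ)]
    rfl
  rw [e2, jointE_sub, jointE_const, jointE_sum]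
  simp only [jointE_const_mul, e3]
  refine sub_le_sub_left ?_ 1
  have hle : ∀ j, P.startedProb t₀ y j t / T * (P.bar t₀ y j * P.truncCost j T) ≤
      P.truncCost j T * (∑ t' ∈ Finset.Icc t₀ T, y j t') / T := fun j => by
    rw [div_mul_eq_mul_div]
    refine div_le_div_of_nonneg_right ?_ hT0.le
    have := mul_le_mul_of_nonneg_left (hy.bar_mul_startedProb_le j (le_max_left t 1))
      (truncCost_nonneg (P := P) j T)
    linarith
  have hnn : ∀ j, 0 ≤ P.truncCost j T * (∑ t' ∈ Finset.Icc t₀ T, y j t') / T := fun j =>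
    div_nonneg (mul_nonneg (truncCost_nonneg j T)
      (Finset.sum_nonneg fun t _ => hy.nonneg j t)) hT0.le
  calc _ ≤ ∑ j ∈ Finset.univ.erase i,
        P.truncCost j T * (∑ t' ∈ Finset.Icc t₀ T, y j t') / T := Finset.sum_le_sum fun j _ => hle j
    _ ≤ ∑ j, P.truncCost j T * (∑ t' ∈ Finset.Icc t₀ T, y j t') / T :=
        Finset.sum_le_sum_of_subset_of_nonneg (Finset.subset_univ _) fun j _ _ => hnn j
    _ ≤ 2 * l := by
        rw [← Finset.sum_div, div_le_iff₀ hT0]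
        linarith [hy.knapsack_max hl (P.bounds_of_mem_slots ht).2.1]

theorem F_eq_sum_marginal (x : Fin n → ℝ) :
    P.F x = P.f 0 + ∑ i, x i * ∑ s, P.p i s * P.jointE x (P.marginal i s) := by
  have e : (fun R φ => P.f (restrictTo φ R)) = fun R φ =>
      P.f 0 + ∑ i, if i ∈ R then P.marginal i (φ i) R φ else 0 := by
    funext R φ
    rw [f_restrictTo_eq_sum_marginal, Finset.sum_ite_mem, Finset.univ_inter]
  rw [F_eq_jointE, e, jointE_add, jointE_const, jointE_sum]
  congr 1
  refine Finset.sum_congr rfl fun i _ => ?_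
  rw [jointE_mem i fun R φ => P.marginal i (φ i) R φ]
  simp only [marginal_insert]
  rw [jointE_resample i]
  simp only [marginal_update, Function.update_self]

/-- Turns the balance condition, which conditions on `i ∈ R`, into an expectation over an
unconditioned `R` with `i` inserted. -/
theorem sum_inclusionProb_probMem_insert (x : Fin n → ℝ)
    (χ : RandomSetMap n) (i : Fin n) :
    x i * (∑ R, inclusionProb x R * χ.probMem (insert i R) i) =
      ∑ R with i ∈ R, inclusionProb x R * χ.probMem R i := by
  rw [← sum_inclusionProb_mem x i fun R => χ.probMem R i, Finset.sum_filter]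
  simp

theorem probMem_nonneg {χ : RandomSetMap n} (h : ∀ R S, 0 ≤ χ R S) (R : Finset (Fin n))
    (i : Fin n) : 0 ≤ χ.probMem R i :=
  Finset.sum_nonneg fun S _ => h R S

/-- The contribution of one item: balance and Markov's bound, combined by Harris' inequality. -/
theorem IsScaledFractional.item_bound (hy : P.IsScaledFractional t₀ l y) (hl0 : 0 ≤ l)
    (hl : l ≤ 1 / 2) (hγ : 0 ≤ γ) (hf : Monotone P.f) (hs : LatticeSubmodular P.f)
    (hc : ∀ i, Monotone (P.c i)) {χ : RandomSetMap n}
    (hχ : IsMonotoneBalancedCRSAt P.Iout γ (P.bar t₀ y) χ) (i : Fin n) :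
    (1 - 2 * l) * γ *
        (P.bar t₀ y i * ∑ s, P.p i s * P.jointE (P.bar t₀ y) (P.marginal i s)) ≤
      P.jointE (P.bar t₀ y) fun R φ =>
        χ.probMem R i * (P.marginal i (φ i) R φ * P.avgSlack t₀ y i R φ) := by
  set x := P.bar t₀ y with hx
  have hx0 : ∀ i, 0 ≤ x i := hy.bar_nonneg
  have hx1 : ∀ i, x i ≤ 1 := fun i => (hy.bar_le i).trans (by linarith)
  have e : (fun (R : Finset (Fin n)) (φ : Fin n → Fin B) =>
      χ.probMem R i * (P.marginal i (φ i) R φ * P.avgSlack t₀ y i R φ)) = fun R φ =>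
      if i ∈ R then χ.probMem R i * (P.marginal i (φ i) R φ * P.avgSlack t₀ y i R φ) else 0 := by
    funext R φ
    split_ifs with hi
    · rfl
    · have : χ.probMem R i = 0 := Finset.sum_eq_zero fun S hS => by
        by_contra h
        exact hi (hχ.subset R S h (Finset.mem_filter.1 hS).2)
      rw [this, zero_mul]
  rw [e, jointE_mem i fun R φ =>
    χ.probMem R i * (P.marginal i (φ i) R φ * P.avgSlack t₀ y i R φ)]
  simp only [marginal_insert, avgSlack_insert]
  rw [mul_left_comm]
  rcases (hx0 i).eq_or_lt with hxi | hxi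
  · rw [← hxi, zero_mul, zero_mul]
  refine mul_le_mul_of_nonneg_left ?_ hxi.le
  -- Once `i` is inserted and its state redrawn as `s`, none of the three factors depends on the old
  -- state of `i`.
  rw [jointE_resample i, Finset.mul_sum]
  simp only [marginal_update, avgSlack_update, Function.update_self]
  refine Finset.sum_le_sum fun s _ => ?_
  rw [mul_left_comm]
  refine mul_le_mul_of_nonneg_left ?_ (P.p_nonneg i s)
  have hA0 : ∀ (R : Finset (Fin n)) (φ : Fin n → Fin B), 0 ≤ χ.probMem (insert i R) i :=
    fun R _ => probMem_nonneg hχ.nonneg _ _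
  have hM0 : ∀ R φ, 0 ≤ P.marginal i s R φ := P.marginal_nonneg hf i s
  have hAanti : ∀ (R R' : Finset (Fin n)) (φ φ' : Fin n → Fin B), R ⊆ R' → φ ≤ φ' →
      χ.probMem (insert i R') i ≤ χ.probMem (insert i R) i := fun R R' φ φ' hR _ =>
    hχ.monotone _ _ (Finset.insert_subset_insert i hR) i (Finset.mem_insert_self i R)
  have hManti : ∀ (R R' : Finset (Fin n)) (φ φ' : Fin n → Fin B), R ⊆ R' → φ ≤ φ' →
      P.marginal i s R' φ' ≤ P.marginal i s R φ := fun R R' φ φ' hR hφ =>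
    P.marginal_anti hs i s hR hφ
  -- Harris twice: first survival against marginal, both nonnegative, then their product against the
  -- slack, which may be negative.
  have h1 := jointE_mul_le_of_nonneg (P := P) hx0 hx1 hA0 hM0 hAanti hManti
  have h2 := jointE_mul_le (P := P) hx0 hx1 (g := P.avgSlack t₀ y i)
    (fun R φ => mul_nonneg (hA0 R φ) (hM0 R φ))
    (fun R R' φ φ' hR hφ => mul_le_mul (hAanti R R' φ φ' hR hφ) (hManti R R' φ φ' hR hφ)
      (hM0 _ _) (hA0 R φ))
    (fun R R' φ φ' hR hφ => hy.avgSlack_anti hc i hR hφ)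
  simp only [mul_assoc] at h2
  refine le_trans ?_ h2
  have hbal : γ ≤ P.jointE x fun R _ => χ.probMem (insert i R) i := by
    have hb := hχ.balanced i hxi
    rw [← sum_inclusionProb_probMem_insert x χ, mul_div_cancel_left₀ _ hxi.ne'] at hb
    rwa [jointE_set]
  have hslack := hy.le_jointE_avgSlack hl0 hxi.ne'
  have hM : 0 ≤ P.jointE x (P.marginal i s) := by
    simpa [jointE_const] using jointE_mono (P := P) hx0 hx1 hM0
  have h3 := (mul_le_mul_of_nonneg_right hbal hM).trans h1
  calc (1 - 2 * l) * γ * P.jointE x (P.marginal i s)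
      = (γ * P.jointE x (P.marginal i s)) * (1 - 2 * l) := by ring
    _ ≤ _ := mul_le_mul h3 hslack (by linarith) ((mul_nonneg hγ hM).trans h3)

/-- The policy `π^io` loses at most the factor `(1 - 2 l) γ` against the multilinear extension. -/
theorem IsScaledFractional.F_le_favgRandom (hy : P.IsScaledFractional t₀ l y) (hl0 : 0 ≤ l)
    (hl : l ≤ 1 / 2) (hγ : 0 ≤ γ) (hγ1 : γ ≤ 1) (hf : Monotone P.f) (hs : LatticeSubmodular P.f)
    (hc : ∀ i, Monotone (P.c i))
    (hχ : IsMonotoneBalancedCRSAt P.Iout γ (P.bar t₀ y) (χ (P.bar t₀ y))) :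
    (1 - 2 * l) * γ * P.F (P.bar t₀ y) ≤ P.favgRandom (P.ioPolicy t₀ y χ) := by
  set x := P.bar t₀ y with hx
  have hx0 : ∀ i, 0 ≤ x i := hy.bar_nonneg
  have hx1 : ∀ i, x i ≤ 1 := fun i => (hy.bar_le i).trans (by linarith)
  have hlow : P.jointE x (fun R φ => P.f 0 + ∑ i, (χ x).probMem R i *
      (P.marginal i (φ i) R φ * P.avgSlack t₀ y i R φ)) ≤ P.favgRandom (P.ioPolicy t₀ y χ) := by
    rw [favgRandom, sum_ioPolicy, jointE_eq_set]
    refine Finset.sum_le_sum fun R _ => ?_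
    by_cases hR : inclusionProb x R = 0
    · rw [← hx, hR, zero_mul, zero_mul]
    refine mul_le_mul_of_nonneg_left ?_ (inclusionProb_nonneg hx0 hx1 R)
    calc _ = ∑ φ, P.prob φ * ∑ S, χ x R S *
          (P.f 0 + ∑ i ∈ S, P.marginal i (φ i) R φ * P.avgSlack t₀ y i R φ) := by
          refine Finset.sum_congr rfl fun φ _ => ?_
          congr 1
          simp only [mul_add, Finset.sum_add_distrib, ← Finset.sum_mul, hχ.sum_eq_one, one_mul]
          congr 1
          simp only [RandomSetMap.probMem, Finset.sum_mul, Finset.mul_sum, Finset.sum_filter]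
          rw [Finset.sum_comm]
          refine Finset.sum_congr rfl fun S _ => ?_
          simp only [ite_mul, zero_mul]
          rw [Finset.sum_ite_mem, Finset.univ_inter]
      _ ≤ ∑ φ, P.prob φ * ∑ S, χ x R S * ∑ τ ∈ P.startTimes t₀ S, P.timesProb t₀ y S τ *
            P.f (restrictTo φ ((P.visit τ (schedule S τ) 0).selected φ)) := by
          refine Finset.sum_le_sum fun φ _ => mul_le_mul_of_nonneg_left ?_ (P.prob_nonneg φ)
          refine Finset.sum_le_sum fun S _ => ?_
          by_cases hS : χ x R S = 0
          · rw [hS, zero_mul, zero_mul]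
          · exact mul_le_mul_of_nonneg_left (hy.sum_timesProb_f_ge hf hs hc (hχ.subset R S hS)
              (fun i hi => sum_startProb (bar_ne_zero_of_inclusionProb_ne_zero hR
                (hχ.subset R S hS hi))) φ) (hχ.nonneg R S)
      _ = _ := by
          simp only [favg, Finset.mul_sum]
          rw [Finset.sum_comm]
          refine Finset.sum_congr rfl fun S _ => ?_
          rw [Finset.sum_comm]
          exact Finset.sum_congr rfl fun τ _ => Finset.sum_congr rfl fun φ _ => by
            rw [← hx]; ring
  refine le_trans ?_ hlow
  rw [jointE_add, jointE_const, jointE_sum, F_eq_sum_marginal, mul_add, Finset.mul_sum]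
  refine add_le_add ?_ (Finset.sum_le_sum fun i _ =>
    hy.item_bound hl0 hl hγ hf hs hc hχ i)
  -- The constant `P.f 0` is earned in full, so the factor `(1 - 2 * l) * γ` is given away on it.
  exact mul_le_of_le_one_left (P.f_nonneg 0)
    (mul_le_one₀ (by linarith) hγ hγ1)

end

end Problem

/-! ### Combining the two estimates. -/

theorem mainTheorem1 (δ : ℕ → ℝ) (hδ_pos : ∀ n, 0 < δ n)
    (hδ : δ =o[Filter.atTop] fun n : ℕ => ((n : ℝ) ^ 3)⁻¹) :
    ∃ ε : ℕ → ℝ, Filter.Tendsto ε Filter.atTop (nhds 0) ∧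
      ∀ (n B : ℕ) (P : Problem n B) (t₀ : ℕ) (β γ : ℝ) (χ : (Fin n → ℝ) → RandomSetMap n),
        Monotone P.f → LatticeSubmodular P.f → (∀ i, Monotone (P.c i)) →
        t₀ ≤ 1 → (∀ i, (∀ s, P.c i s ≤ P.C) → ∀ s, t₀ + P.c i s ≤ P.C) →
        0 ≤ β → β ≤ 1 → 0 ≤ γ → γ ≤ 1 →
        IsMonotoneBalancedCRS P.Iout β γ χ →
        (∃ y, P.IsGreedyOutput t₀ (min β (1 / 4)) (δ n) y) ∧
        ∀ y, P.IsGreedyOutput t₀ (min β (1 / 4)) (δ n) y →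
          (P.ioPolicy t₀ y χ).IsProbability ∧
          P.FeasibleRandom (P.ioPolicy t₀ y χ) ∧
          ∀ π : Policy n B, P.Feasible π →
            (1 - min (2 * β) (1 / 2)) * γ * (1 - Real.exp (-min β (1 / 4)) - ε n) * P.favg π ≤
              P.favgRandom (P.ioPolicy t₀ y χ) := by
  -- The greedy loss is `2 * n * δ n`; the extra `2 * δ n` makes the claimed factor negative when `δ
  -- n > 1/2`, where the greedy estimate is unavailable.
  refine ⟨fun n => 2 * (n + 1) * δ n, ?_, ?_⟩
  · have h1 : (fun n : ℕ => 2 * ((n : ℝ) + 1)) =O[Filter.atTop] fun n : ℕ => (n : ℝ) ^ 3 := by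
      refine Asymptotics.IsBigO.of_bound 4 ?_
      filter_upwards [Filter.eventually_ge_atTop 1] with n hn
      have hn' : (1 : ℝ) ≤ n := by exact_mod_cast hn
      have h3 : (n : ℝ) ≤ (n : ℝ) ^ 3 := le_self_pow₀ hn' (by norm_num)
      rw [Real.norm_of_nonneg (by positivity), Real.norm_of_nonneg (by positivity)]
      linarith
    refine (Asymptotics.isLittleO_one_iff ℝ).1 ((h1.mul_isLittleO hδ).trans_isBigO ?_)
    refine Asymptotics.IsBigO.of_bound 1 (Filter.Eventually.of_forall fun n => ?_)
    by_cases hn : ((n : ℝ) ^ 3) = 0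
    · simp [hn]
    · simp [mul_inv_cancel₀ hn]
  · intro n B P t₀ β γ χ hf hs hc ht₀ hC hβ hβ1 hγ hγ1 hχ
    set l := min β (1 / 4) with hl
    have hl0 : 0 ≤ l := le_min hβ (by norm_num)
    have hl4 : l ≤ 1 / 4 := min_le_right _ _
    have h2l : min (2 * β) (1 / 2) = 2 * l := by
      rw [hl, mul_min_of_nonneg _ _ (by norm_num : (0 : ℝ) ≤ 2)]
      norm_num
    refine ⟨P.exists_isGreedyOutput t₀ l (δ n), fun y hy => ?_⟩
    have hsc := (hy.exp_bound (hδ_pos n) hl0 hl4).1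
    -- The scheme applies at `ȳ`, which lies in `l • P_F` and hence in `β • P_F`.
    have hχy := hχ _ (P.smul_familyPolytope_subset hl0 (min_le_left _ _) hsc.bar_mem)
    have hprob := hsc.isProbability_ioPolicy (by linarith) hχy
    refine ⟨hprob, Problem.feasibleRandom_ioPolicy hχy, fun π hπ => ?_⟩
    have hx0 := hsc.bar_nonneg
    have hF0 := P.F_nonneg hx0 fun i => (hsc.bar_le i).trans (by linarith)
    have hO := P.favg_nonneg π
    have hexp := Real.exp_pos (-l)
    have hδn := hδ_pos n
    rw [h2l, mul_assoc]
    refine le_trans (mul_le_mul_of_nonneg_left ?_ (mul_nonneg (by linarith) hγ))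
      (hsc.F_le_favgRandom hl0 (by linarith) hγ hγ1 hf hs hc hχy)
    by_cases hbig : δ n ≤ 1 / 2
    · refine le_trans (mul_le_mul_of_nonneg_right ?_ hO)
        (hy.favg_le hδn hbig hl0 hl4 hf hs ht₀ hC hπ)
      linarith
    · refine le_trans (mul_nonpos_of_nonpos_of_nonneg ?_ hO) hF0
      have : 0 ≤ (n : ℝ) * δ n := by positivity
      linarith
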